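/- A Dirichlet polynomial is a finite sum $P(s)=\sum_{n\ge 1}a_n n^{-s}$ with complex coefficients; put $P_\sigma(s)=P(s+\sigma)$, and let $\mathscr{B}P(z)=\sum_n a_n\prod_j z_j^{\nu_j(n)}$ be its Bohr lift, where $n=\prod_j p_j^{\nu_j(n)}$ is the prime factorization of $n$ and $z=(z_1,z_2,\dots)$ lies in the infinite-dimensional torus $\mathbb{T}^\infty$ with normalized Haar measure $m_\infty$. For $0<p,u,v<\infty$ and $\alpha>-1$ put $$\|P\|_{\mathcal{H}^p}=\Big(\int_{\mathbb{T}^\infty}|\mathscr{B}P|^p\,dm_\infty\Big)^{1/p},\qquad \|P\|_{\mathcal{H}^{u,v}_\alpha}=\Big(\int_0^\infty\|P_\sigma\|_{\mathcal{H}^u}^v\,d\mu_\alpha(\sigma)\Big)^{1/v},\qquad d\mu_\alpha(\sigma)=\frac{2^{\alpha+1}}{\Gamma(\alpha+1)}\sigma^\alpha e^{-2\sigma}\,d\sigma .$$ The Hardy space $\mathcal{H}^p$ and the mixed norm space $\mathcal{H}^{u,v}_\alpha$ are the completions of the space of Dirichlet polynomials with respect to these (quasi-)norms, regarded as spaces of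 Dirichlet series: a Dirichlet series that converges on some half-plane belongs to the space if and only if it is the coefficientwise limit of a sequence of Dirichlet polynomials that is Cauchy in the (quasi-)norm. **Proposition.** Let $0<p,u,v<\infty$ and $\alpha>-1$. Then 1. $\mathcal{H}^p\subset\mathcal{H}^{u,v}_\alpha$ if and only if $p\ge u$; 2. $\mathcal{H}^{u,v}_\alpha\not\subset\mathcal{H}^p$; more precisely, the Dirichlet series $\sum_{k=0}^\infty 2^{-2^k s}$ belongs to $\mathcal{H}^{u,v}_\alpha$ but not to $\mathcal{H}^p$. -/

import Mathlib

open MeasureTheory Filter Topology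

noncomputable section

/-- A Dirichlet series `∑ a_n n^{-s}`, `n ≥ 1`, is recorded by its coefficients `a : ℕ+ → ℂ`. The
coefficients determine the sum function as soon as the series converges on some half-plane. -/
abbrev DirichletSeries : Type := ℕ+ → ℂ

/-- A Dirichlet polynomial `∑ a_n n^{-s}`: only finitely many coefficients are nonzero. -/
abbrev DirichletPolynomial : Type := ℕ+ →₀ ℂ

/-- The space of Dirichlet series that converge (not necessarily absolutely) on some half-plane
`{s : ℂ | θ < Re s}`, with `θ` real. -/
def convergentDirichletSeries : Set DirichletSeries :=
  {a | ∃ θ : ℝ, ∀ s : ℂ, θ < s.re → ∃ l : ℂ,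
    Tendsto (fun N : ℕ => ∑ n ∈ Finset.range N, a n.succPNat * ((n.succPNat : ℕ) : ℂ) ^ (-s))
      atTop (𝓝 l)}

/-- The infinite-dimensional torus, with one coordinate for each prime. The coordinate `x p`, in
`ℝ / ℤ`, stands for the point `z_p = exp (2 π i x_p)` of the unit circle. -/
abbrev PrimeTorus : Type := Nat.Primes → UnitAddCircle

/-- The normalized Haar measure of the infinite-dimensional torus: the product of the normalized
Haar (Lebesgue) measures of the circles. -/
def primeTorusMeasure : Measure PrimeTorus :=
  Measure.infinitePi fun _ : Nat.Primes => (AddCircle.haarAddCircle : Measure UnitAddCircle)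

/-- The monomial `z^{ν(n)} = ∏_p z_p^{ν_p(n)}`, where `n = ∏_p p^{ν_p(n)}`. The factor
`z_p^k = exp (2 π i k x_p)` is `fourier k (x p)`. The product is finite, since `ν_p(n) = 0` unless
`p` divides `n`. -/
def bohrMonomial (n : ℕ+) (x : PrimeTorus) : ℂ :=
  ∏ᶠ p : Nat.Primes, fourier ((n : ℕ).factorization (p : ℕ) : ℤ) (x p)

namespace DirichletPolynomial

/-- The Bohr lift `z ↦ ∑ a_n z^{ν(n)}` of the Dirichlet polynomial `∑ a_n n^{-s}`. -/
def bohrLift (P : DirichletPolynomial) (x : PrimeTorus) : ℂ :=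
  P.sum fun n c => c * bohrMonomial n x

/-- The Hardy (quasi-)norm `(∫ |𝓑 P|^p dm)^{1/p}` of a Dirichlet polynomial. -/
def hardyNorm (p : ℝ) (P : DirichletPolynomial) : ℝ :=
  (∫ x, ‖bohrLift P x‖ ^ p ∂primeTorusMeasure) ^ (1 / p)

/-- The horizontal translate `P_σ(s) = P(s + σ)`, with coefficients `a_n n^{-σ}`. -/
def translate (σ : ℝ) (P : DirichletPolynomial) : DirichletPolynomial :=
  Finsupp.onFinset P.support (fun n => P n * (((n : ℕ) : ℝ) ^ (-σ) : ℝ)) fun n hn => by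
    rw [Finsupp.mem_support_iff]
    exact left_ne_zero_of_mul hn

end DirichletPolynomial

/-- The measure `dμ_α(σ) = 2^{α+1} / Γ(α+1) σ^α e^{-2σ} dσ` on `(0, ∞)`. -/
def muMeasure (α : ℝ) : Measure ℝ :=
  (volume.restrict (Set.Ioi 0)).withDensity fun σ =>
    ENNReal.ofReal (2 ^ (α + 1) / Real.Gamma (α + 1) * σ ^ α * Real.exp (-2 * σ))

/-- The mixed (quasi-)norm `(∫_0^∞ ‖P_σ‖_{H^u}^v dμ_α(σ))^{1/v}` of a Dirichlet polynomial. -/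
def DirichletPolynomial.mixedNorm (u v α : ℝ) (P : DirichletPolynomial) : ℝ :=
  (∫ σ, (P.translate σ).hardyNorm u ^ v ∂muMeasure α) ^ (1 / v)

/-- The completion of the space of Dirichlet polynomials with respect to a (quasi-)norm `N`,
realized as a space of Dirichlet series: a Dirichlet series belongs to it if it is the
coefficientwise limit of a sequence of Dirichlet polynomials that is Cauchy with respect to `N`. -/
def dirichletCompletion (N : DirichletPolynomial → ℝ) : Set DirichletSeries :=
  {a | a ∈ convergentDirichletSeries ∧ ∃ P : ℕ → DirichletPolynomial,
    (∀ ε : ℝ, 0 < ε → ∃ K : ℕ, ∀ j k : ℕ, K ≤ j → K ≤ k → N (P j - P k) < ε) ∧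
    ∀ n : ℕ+, Tendsto (fun j => P j n) atTop (𝓝 (a n))}

/-- The Hardy space `H^p` of Dirichlet series. -/
def hardySpace (p : ℝ) : Set DirichletSeries :=
  dirichletCompletion (DirichletPolynomial.hardyNorm p)

/-- The mixed norm space `H^{u,v}_α` of Dirichlet series. -/
def mixedNormSpace (u v α : ℝ) : Set DirichletSeries :=
  dirichletCompletion (DirichletPolynomial.mixedNorm u v α)

open Classical in
/-- The Dirichlet series `∑_{k ≥ 0} 2^{-2^k s}`: the coefficient of `n^{-s}` is `1` if `n = 2^(2^k)`
for some `k ≥ 0`, and `0` otherwise. -/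
def lacunarySeries : DirichletSeries :=
  fun n => if ∃ k : ℕ, (n : ℕ) = 2 ^ 2 ^ k then 1 else 0

end

/-! Inclusion for u ≤ p. Horizontal translation by σ ≥ 0 multiplies the variable z_p by p^{-σ} ≤ 1,
and |F|^u is subharmonic for every polynomial F and every u > 0. Hence ‖P_σ‖_u ≤ ‖P‖_u ≤ ‖P‖_p, and
since μ_α is finite, Hardy-Cauchy sequences are Cauchy in the mixed norm. Subharmonicity
(`Polynomial.norm_eval_rpow_le_circleAverage`) does the work that norm and duality arguments cannot
do for exponents below 1. Slicing the torus along one-parameter subgroups t ↦ (w(p) t)_p carries it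
to Bohr lifts: dilations are contractions (`hardyIntegral_multiplier_pow_le`), and for each r < 1
the projection onto degree m has norm at most C_r r^{-m} (`hardyIntegral_homogeneous_le`).

No inclusion for p < u. Let Q_k have Bohr lift ∏_{i<k} (z_{2i} + z_{2i+1}), in variables of primes
at most 2^{2k}. Its H^q norm is A_q^k, where A_q is the L^q norm of 1 + z on the circle, and A_p <
A_u. For γ slightly below 1/A_p the series ∑ γ^k Q_k lies in H^p. If it were in the mixed norm
space, projecting onto degree k would bound the mixed norm of γ^k Q_k by C r^{-k}. But translating
Q_k by σ ≤ 1/(2k²) costs at most a factor 2, and μ_α(0, 1/(2k²)] decays only polynomially, so that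
norm is at least (γ A_u)^k times a power of 1/k. This is impossible once γ A_u r > 1.

The lacunary series. In the mixed norm, the triangle inequality for the supremum gives ∑ 2^{-2^k σ}
= O(σ^{-ε}) for every ε > 0, which is integrable enough. In H^p one may take p ≤ 1. Rotating z_2 by
ζ = exp(2πi/2^K) would move an element of H^p by little when K is large. For this series the
rotation changes only the terms k < K, by ζ^{2^k} - 1: a polynomial of supremum at most 7 with a
coefficient equal to -2, so its p-th mean stays away from 0. Dilation by some r < 1 turns
coefficientwise limits into limits in norm. -/

noncomputable section

local notation "𝐞" => (fourier 1 : C(UnitAddCircle, ℂ))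

local notation "ℏ" => (AddCircle.haarAddCircle : Measure UnitAddCircle)

/-! ### Subharmonicity of |F|^u for polynomials on the unit disc -/

section PoissonJensen

open Real Metric InnerProductSpace

lemma continuousOn_poissonKernel_sphere {w : ℂ} (hw : w ∈ ball (0 : ℂ) 1) :
    ContinuousOn (poissonKernel 0 w) (sphere 0 |1|) := by
  rw [poissonKernel_eq_re_herglotzRieszKernel]
  exact Complex.continuous_re.comp_continuousOn (continuousOn_herglotzRieszKernel_sphere hw)

lemma continuous_poissonKernel_circleMap {w : ℂ} (hw : w ∈ ball (0 : ℂ) 1) :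
    Continuous fun θ => poissonKernel 0 w (circleMap 0 1 θ) :=
  (continuousOn_poissonKernel_sphere hw).comp_continuous (continuous_circleMap 0 1)
    fun θ => circleMap_mem_sphere' 0 1 θ

lemma poissonKernel_nonneg {w z : ℂ} (hw : w ∈ ball (0 : ℂ) 1) (hz : z ∈ sphere (0 : ℂ) |1|) :
    0 ≤ poissonKernel 0 w z := by
  simp only [mem_ball, dist_zero_right, mem_sphere, abs_one] at hw hz
  rw [poissonKernel_def, sub_zero, sub_zero, hz]
  have := norm_nonneg w
  exact div_nonneg (by nlinarith) (by positivity)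

lemma poissonKernel_le {w z : ℂ} (hw : w ∈ ball (0 : ℂ) 1) (hz : z ∈ sphere (0 : ℂ) |1|) :
    poissonKernel 0 w z ≤ (1 + ‖w‖) / (1 - ‖w‖) := by
  rw [abs_one] at hz
  have := re_herglotzRieszKernel_le hz hw
  rw [poissonKernel_eq_re_herglotzRieszKernel]
  simpa [herglotzRieszKernel_def] using this

lemma circleAverage_poissonKernel {w : ℂ} (hw : w ∈ ball (0 : ℂ) 1) :
    circleAverage (poissonKernel 0 w) 0 1 = 1 := by
  have h : HarmonicOnNhd (fun _ : ℂ => (1 : ℝ)) (closedBall 0 1) := fun x _ => harmonicAt_const 1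
  have := h.circleAverage_poissonKernel_smul hw
  simpa using (circleAverage_congr_sphere fun z _ => by simp).trans this

lemma circleIntegrable_poissonKernel_mul {w : ℂ} (hw : w ∈ ball (0 : ℂ) 1) {g : ℂ → ℝ}
    (hg : CircleIntegrable g 0 1) :
    CircleIntegrable (fun z => poissonKernel 0 w z * g z) 0 1 :=
  IntervalIntegrable.continuousOn_mul hg (continuous_poissonKernel_circleMap hw).continuousOn

lemma circleIntegrable_log_norm_sub (a : ℂ) : CircleIntegrable (fun z => log ‖z - a‖) 0 1 :=
  (analyticOnNhd_id.sub analyticOnNhd_const).meromorphicOn.circleIntegrable_log_norm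

lemma norm_sub_eq_norm_one_sub_conj_mul {a z : ℂ} (hz : ‖z‖ = 1) :
    ‖z - a‖ = ‖1 - (starRingEnd ℂ) a * z‖ := by
  have h : 1 - (starRingEnd ℂ) a * z = z * (starRingEnd ℂ) (z - a) := by
    rw [map_sub, mul_sub, Complex.mul_conj, Complex.normSq_eq_norm_sq, hz]
    push_cast
    ring
  rw [h, norm_mul, hz, one_mul, RCLike.norm_conj]

/-- The difference of the squares of the two sides is (1 - |a|²)(1 - |w|²). -/
lemma norm_sub_le_norm_one_sub_conj_mul {a w : ℂ} (ha : ‖a‖ ≤ 1) (hw : ‖w‖ ≤ 1) :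
    ‖w - a‖ ≤ ‖1 - (starRingEnd ℂ) a * w‖ := by
  rw [← sq_le_sq₀ (norm_nonneg _) (norm_nonneg _), ← Complex.normSq_eq_norm_sq,
    ← Complex.normSq_eq_norm_sq]
  have h1 : Complex.normSq a ≤ 1 := by
    rw [Complex.normSq_eq_norm_sq]; nlinarith [norm_nonneg a]
  have h2 : Complex.normSq w ≤ 1 := by
    rw [Complex.normSq_eq_norm_sq]; nlinarith [norm_nonneg w]
  rw [Complex.normSq_apply] at *
  simp only [Complex.normSq_apply, Complex.sub_re, Complex.sub_im, Complex.mul_re, Complex.mul_im,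
    Complex.conj_re, Complex.conj_im, Complex.one_re, Complex.one_im] at *
  nlinarith [mul_nonneg (sub_nonneg.2 h1) (sub_nonneg.2 h2)]

/-- The function `log |z - a|` is bounded by its Poisson integral. -/
lemma log_norm_sub_le_circleAverage {a w : ℂ} (hw : w ∈ ball (0 : ℂ) 1) (hwa : w ≠ a) :
    log ‖w - a‖ ≤ circleAverage (fun z => poissonKernel 0 w z * log ‖z - a‖) 0 1 := by
  have hw' : ‖w‖ < 1 := by simpa using hw
  rcases lt_trichotomy ‖a‖ 1 with ha | ha | ha
  -- For |a| < 1, replace z - a by 1 - āz: it has the same modulus on the circle, no zero in the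
  -- closed disc, and a modulus at least as large inside.
  · have hne : ∀ z : ℂ, ‖z‖ ≤ 1 → 1 - (starRingEnd ℂ) a * z ≠ 0 := by
      intro z hz h0
      have : ‖(starRingEnd ℂ) a * z‖ = 1 := by rw [← sub_eq_zero.1 h0, norm_one]
      rw [norm_mul, RCLike.norm_conj] at this
      nlinarith [norm_nonneg a, norm_nonneg z]
    have hh : HarmonicOnNhd (fun z : ℂ => log ‖1 - (starRingEnd ℂ) a * z‖) (closedBall 0 1) :=
      fun z hz => AnalyticAt.harmonicAt_log_norm (by fun_prop) (hne z (by simpa using hz))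
    have h1 := hh.circleAverage_poissonKernel_smul hw
    have h2 : circleAverage (fun z => poissonKernel 0 w z * log ‖z - a‖) 0 1 =
        log ‖1 - (starRingEnd ℂ) a * w‖ := by
      rw [← h1]
      apply circleAverage_congr_sphere
      intro z hz
      have hz' : ‖z‖ = 1 := by simpa using hz
      simp only [Pi.smul_apply', smul_eq_mul]
      rw [norm_sub_eq_norm_one_sub_conj_mul hz']
    rw [h2]
    exact log_le_log (norm_pos_iff.2 (sub_ne_zero.2 hwa))
      (norm_sub_le_norm_one_sub_conj_mul ha.le hw'.le)
  · have h := circleAverage_re_herglotzRieszKernel_mul_log (c := 0) (R := 1) (ρ := a)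
      (by simpa using ha) hw
    rw [← poissonKernel_eq_re_herglotzRieszKernel] at h
    exact h.symm.le
  · have hh : HarmonicOnNhd (fun z : ℂ => log ‖z - a‖) (closedBall 0 1) := by
      refine fun z hz => AnalyticAt.harmonicAt_log_norm (f := fun z => z - a) (by fun_prop) ?_
      intro h0
      have : ‖z‖ ≤ 1 := by simpa using hz
      rw [sub_eq_zero.1 h0] at this
      linarith
    exact (hh.circleAverage_poissonKernel_smul hw).symm.le

/-- **Jensen's inequality** for the exponential function and the Poisson kernel. -/
lemma exp_circleAverage_poissonKernel_mul_le {w : ℂ} (hw : w ∈ ball (0 : ℂ) 1) {L G : ℂ → ℝ}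
    (hL : CircleIntegrable L 0 1) (hG : CircleIntegrable G 0 1)
    {s : Set ℂ} (hs : s.Countable) (h : ∀ z ∉ s, exp (L z) ≤ G z) :
    exp (circleAverage (fun z => poissonKernel 0 w z * L z) 0 1) ≤
      circleAverage (fun z => poissonKernel 0 w z * G z) 0 1 := by
  set a := circleAverage (fun z => poissonKernel 0 w z * L z) 0 1 with ha
  have hP : CircleIntegrable (poissonKernel 0 w) 0 1 :=
    (continuous_poissonKernel_circleMap hw).intervalIntegrable _ _
  have hPL := circleIntegrable_poissonKernel_mul hw hL
  have hPG := circleIntegrable_poissonKernel_mul hw hG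
  -- The tangent line of exp at the mean a, evaluated at L, has Poisson integral exp a because the
  -- kernel has mass 1. It then suffices to compare tangent and exponential pointwise.
  have h1 : circleAverage (fun z => exp a * (1 - a) * poissonKernel 0 w z +
      exp a * (poissonKernel 0 w z * L z)) 0 1 = exp a := by
    rw [circleAverage_fun_add]
    · have e1 := circleAverage_fun_smul (𝕜 := ℝ) (a := exp a * (1 - a)) (f := poissonKernel 0 w)
        (c := 0) (R := 1)
      have e2 := circleAverage_fun_smul (𝕜 := ℝ) (a := exp a)
        (f := fun z => poissonKernel 0 w z * L z) (c := 0) (R := 1)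
      simp only [smul_eq_mul] at e1 e2
      rw [e1, e2, circleAverage_poissonKernel hw, ← ha]
      ring
    · exact hP.const_mul _
    · exact hPL.const_mul _
  rw [← h1, circleAverage_def, circleAverage_def]
  refine smul_le_smul_of_nonneg_left ?_ (by positivity)
  refine intervalIntegral.integral_mono_ae (by positivity) ?_ hPG ?_
  · exact (hP.const_mul _).add (hPL.const_mul _)
  · have hz := (hs.preimage_circleMap 0 one_ne_zero).measure_zero volume
    filter_upwards [measure_eq_zero_iff_ae_notMem.mp hz] with θ hθ
    have h2 := h _ hθ
    have h3 := poissonKernel_nonneg hw (circleMap_mem_sphere' 0 1 θ)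
    set z := circleMap 0 1 θ
    have h4 : exp a * (1 + (L z - a)) ≤ G z := by
      refine le_trans ?_ h2
      have : exp (L z) = exp a * exp (L z - a) := by rw [← exp_add]; ring_nf
      rw [this]
      exact mul_le_mul_of_nonneg_left (by linarith [add_one_le_exp (L z - a)]) (exp_pos a).le
    nlinarith [mul_le_mul_of_nonneg_left h4 h3]

/-- The function `∑ log |z - a|` is bounded by its Poisson integral. -/
lemma sum_log_norm_sub_le_circleAverage {w : ℂ} (hw : w ∈ ball (0 : ℂ) 1) (S : Multiset ℂ) :
    w ∉ S → CircleIntegrable (fun z => (S.map fun a => log ‖z - a‖).sum) 0 1 ∧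
      (S.map fun a => log ‖w - a‖).sum ≤
        circleAverage (fun z => poissonKernel 0 w z * (S.map fun a => log ‖z - a‖).sum) 0 1 := by
  induction S using Multiset.induction_on with
  | empty =>
    intro _
    simp only [Multiset.map_zero, Multiset.sum_zero, mul_zero]
    exact ⟨circleIntegrable_const _ _ _, (circleAverage_const _ _ _).symm.le⟩
  | cons a S ih =>
    intro h
    rw [Multiset.mem_cons, not_or] at h
    obtain ⟨h1, h2⟩ := ih h.2
    simp only [Multiset.map_cons, Multiset.sum_cons, mul_add]
    refine ⟨(circleIntegrable_log_norm_sub a).add h1, ?_⟩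
    rw [circleAverage_fun_add (circleIntegrable_poissonKernel_mul hw
      (circleIntegrable_log_norm_sub a)) (circleIntegrable_poissonKernel_mul hw h1)]
    exact add_le_add (log_norm_sub_le_circleAverage hw h.1) h2

lemma prod_norm_sub_rpow_eq_exp {u : ℝ} {z : ℂ} (S : Multiset ℂ) :
    z ∉ S → (S.map fun a => ‖z - a‖).prod ^ u = exp (u * (S.map fun a => log ‖z - a‖).sum) := by
  induction S using Multiset.induction_on with
  | empty => simp
  | cons a S ih =>
    intro h
    rw [Multiset.mem_cons, not_or] at h
    simp only [Multiset.map_cons, Multiset.sum_cons, Multiset.prod_cons, mul_add, exp_add]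
    have hnn : 0 ≤ (S.map fun a => ‖z - a‖).prod := by
      refine Multiset.prod_nonneg fun x hx => ?_
      obtain ⟨a, -, rfl⟩ := Multiset.mem_map.1 hx
      exact norm_nonneg _
    rw [mul_rpow (norm_nonneg _) hnn, ih h.2,
      rpow_def_of_pos (norm_pos_iff.2 (sub_ne_zero.2 h.1)), mul_comm u (log _)]

/-- For a polynomial `F` and `u > 0`, the function `|F|^u` is bounded in the unit disc by its
Poisson integral. -/
theorem Polynomial.norm_eval_rpow_le_circleAverage (F : Polynomial ℂ) {u : ℝ} (hu : 0 < u) {w : ℂ}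
    (hw : w ∈ ball (0 : ℂ) 1) :
    ‖F.eval w‖ ^ u ≤ circleAverage (fun z => poissonKernel 0 w z * ‖F.eval z‖ ^ u) 0 1 := by
  rcases eq_or_ne (F.eval w) 0 with h0 | h0
  · rw [h0, norm_zero, zero_rpow hu.ne']
    exact circleAverage_nonneg_of_nonneg fun z hz => mul_nonneg (poissonKernel_nonneg hw hz)
      (by positivity)
  have hF : F ≠ 0 := by rintro rfl; simp at h0
  have hnn : ∀ z, 0 ≤ (F.roots.map fun a => ‖z - a‖).prod := by
    refine fun z => Multiset.prod_nonneg fun x hx => ?_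
    obtain ⟨a, -, rfl⟩ := Multiset.mem_map.1 hx
    exact norm_nonneg _
  have hfac : ∀ z, ‖F.eval z‖ = ‖F.leadingCoeff‖ * (F.roots.map fun a => ‖z - a‖).prod := by
    intro z
    conv_lhs => rw [(IsAlgClosed.splits F).eq_prod_roots]
    rw [Polynomial.eval_mul, Polynomial.eval_C, norm_mul, Polynomial.eval_multiset_prod,
      Multiset.map_map, ← normHom_apply, ← normHom_apply, map_multiset_prod, Multiset.map_map]
    simp
  -- Roots are excluded because `Real.log 0 = 0` makes the right side positive there. They form a
  -- finite set, so the integral inequality does not see them; the case F(w) = 0 was settled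
  -- separately for the same reason.
  have hexp : ∀ z ∉ F.roots, ‖F.eval z‖ ^ u = exp (u * log ‖F.leadingCoeff‖ +
      u * (F.roots.map fun a => log ‖z - a‖).sum) := by
    intro z hz
    rw [hfac, mul_rpow (norm_nonneg _) (hnn z), prod_norm_sub_rpow_eq_exp _ hz,
      rpow_def_of_pos (norm_pos_iff.2 (Polynomial.leadingCoeff_ne_zero.2 hF)), exp_add,
      mul_comm u (log _)]
  have hwr : w ∉ F.roots := fun h => h0 (Polynomial.isRoot_of_mem_roots h)
  obtain ⟨h1, h2⟩ := sum_log_norm_sub_le_circleAverage hw F.roots hwr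
  have hL : CircleIntegrable (fun z => u * log ‖F.leadingCoeff‖ +
      u * (F.roots.map fun a => log ‖z - a‖).sum) 0 1 :=
    (circleIntegrable_const _ _ _).add (h1.const_mul _)
  have hG : CircleIntegrable (fun z => ‖F.eval z‖ ^ u) 0 1 := by
    refine ContinuousOn.circleIntegrable zero_le_one (Continuous.continuousOn ?_)
    exact F.continuous.norm.rpow_const fun _ => Or.inr hu.le
  refine le_trans ?_ (exp_circleAverage_poissonKernel_mul_le hw hL hG
    (F.roots.toFinset.finite_toSet.countable) fun z hz => (hexp z (by simpa using hz)).symm.le)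
  rw [hexp w hwr, exp_le_exp]
  have e : (fun z => poissonKernel 0 w z * (u * log ‖F.leadingCoeff‖ +
      u * (F.roots.map fun a => log ‖z - a‖).sum)) = fun z =>
      (u * log ‖F.leadingCoeff‖) • poissonKernel 0 w z +
      u • (poissonKernel 0 w z * (F.roots.map fun a => log ‖z - a‖).sum) := by
    ext z; simp only [smul_eq_mul]; ring
  have hP : CircleIntegrable (poissonKernel 0 w) 0 1 :=
    (continuous_poissonKernel_circleMap hw).intervalIntegrable _ _
  have hP1 : CircleIntegrable (fun z => (u * log ‖F.leadingCoeff‖) • poissonKernel 0 w z) 0 1 :=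
    hP.const_mul _
  have hP2 : CircleIntegrable (fun z => u • (poissonKernel 0 w z *
      (F.roots.map fun a => log ‖z - a‖).sum)) 0 1 :=
    (circleIntegrable_poissonKernel_mul hw h1).const_mul _
  rw [e, circleAverage_fun_add hP1 hP2, circleAverage_fun_smul,
    circleAverage_fun_smul, circleAverage_poissonKernel hw]
  simp only [smul_eq_mul, mul_one]
  gcongr

end PoissonJensen

/-! ### Means over the circle ℝ / ℤ and Cauchy estimates -/

section UnitCircle

open Real Metric

/-- The circle average over the unit circle as an integral over `ℝ / ℤ`. -/
lemma circleAverage_eq_integral_addCircle (f : ℂ → ℝ) :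
    circleAverage f 0 1 = ∫ t, f (𝐞 t) ∂ℏ := by
  rw [AddCircle.integral_haarAddCircle, inv_one, one_smul,
    ← AddCircle.intervalIntegral_preimage 1 0, circleAverage_def, zero_add]
  have h := intervalIntegral.integral_comp_mul_left (fun θ => f (circleMap 0 1 θ))
    (c := 2 * π) (by positivity) (a := 0) (b := 1)
  rw [mul_zero, mul_one] at h
  rw [← h]
  refine intervalIntegral.integral_congr fun t _ => ?_
  simp only [fourier_coe_apply, circleMap, Complex.ofReal_one, one_mul, zero_add, Int.cast_one]
  congr 2
  push_cast
  ring_nf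

/-- The Poisson kernel of the point `w` of the unit disc, as a function on `ℝ / ℤ`. -/
def circlePoisson (w : ℂ) (t : UnitAddCircle) : ℝ := poissonKernel 0 w (𝐞 t)

lemma fourier_one_mem_sphere (t : UnitAddCircle) : 𝐞 t ∈ sphere (0 : ℂ) |1| := by
  rw [mem_sphere_zero_iff_norm, fourier_apply, Circle.norm_coe, abs_one]

lemma norm_fourier_apply (n : ℤ) (t : UnitAddCircle) : ‖fourier n t‖ = 1 := by
  rw [fourier_apply, Circle.norm_coe]

lemma continuous_circlePoisson {w : ℂ} (hw : ‖w‖ < 1) : Continuous (circlePoisson w) :=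
  (continuousOn_poissonKernel_sphere (by simpa using hw)).comp_continuous
    (map_continuous _) fourier_one_mem_sphere

lemma circlePoisson_le {w : ℂ} (hw : ‖w‖ < 1) (t : UnitAddCircle) :
    circlePoisson w t ≤ (1 + ‖w‖) / (1 - ‖w‖) :=
  poissonKernel_le (by simpa using hw) (fourier_one_mem_sphere t)

lemma integral_circlePoisson {w : ℂ} (hw : ‖w‖ < 1) : ∫ t, circlePoisson w t ∂ℏ = 1 := by
  refine Eq.trans ?_ (circleAverage_poissonKernel (w := w) (by simpa using hw))
  rw [circleAverage_eq_integral_addCircle]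
  rfl

lemma Polynomial.norm_eval_rpow_le_integral (F : Polynomial ℂ) {u : ℝ} (hu : 0 < u) {w : ℂ}
    (hw : ‖w‖ < 1) :
    ‖F.eval w‖ ^ u ≤ ∫ t, circlePoisson w t * ‖F.eval (𝐞 t)‖ ^ u ∂ℏ := by
  refine (F.norm_eval_rpow_le_circleAverage hu (by simpa using hw)).trans_eq ?_
  rw [circleAverage_eq_integral_addCircle]
  rfl

lemma Continuous.integrable_haarAddCircle {E : Type*} [NormedAddCommGroup E]
    {f : UnitAddCircle → E} (hf : Continuous f) : Integrable f ℏ :=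
  hf.integrable_of_hasCompactSupport (HasCompactSupport.of_compactSpace f)

lemma Polynomial.continuous_norm_eval_fourier_rpow (F : Polynomial ℂ) {u : ℝ} (hu : 0 < u) :
    Continuous fun t : UnitAddCircle => ‖F.eval (𝐞 t)‖ ^ u :=
  (F.continuous.comp (map_continuous _)).norm.rpow_const fun _ => Or.inr hu.le

/-- The Poisson kernel is traded for its maximum over the circle; at w = 0 this constant is 1. -/
lemma Polynomial.norm_eval_rpow_le (F : Polynomial ℂ) {u : ℝ} (hu : 0 < u) {w : ℂ}
    (hw : ‖w‖ < 1) :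
    ‖F.eval w‖ ^ u ≤ (1 + ‖w‖) / (1 - ‖w‖) * ∫ t, ‖F.eval (𝐞 t)‖ ^ u ∂ℏ := by
  refine (F.norm_eval_rpow_le_integral hu hw).trans ?_
  rw [← integral_const_mul]
  have hc := F.continuous_norm_eval_fourier_rpow hu
  refine integral_mono ((continuous_circlePoisson hw).mul hc).integrable_haarAddCircle
    (hc.const_smul ((1 + ‖w‖) / (1 - ‖w‖))).integrable_haarAddCircle fun t => ?_
  exact mul_le_mul_of_nonneg_right (circlePoisson_le hw t) (by positivity)

lemma fourier_one_pow (k : ℕ) (t : UnitAddCircle) : 𝐞 t ^ k = fourier (k : ℤ) t := by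
  rw [fourier_apply, fourier_apply, one_smul, natCast_zsmul, AddCircle.toCircle_nsmul]
  rfl

/-- The coefficients of a polynomial are bounded by its mean on the unit circle. -/
lemma Polynomial.norm_coeff_le_integral (F : Polynomial ℂ) (m : ℕ) :
    ‖F.coeff m‖ ≤ ∫ t, ‖F.eval (𝐞 t)‖ ∂ℏ := by
  have h : F.coeff m = ∫ t, fourier (-(m : ℤ)) t * F.eval (𝐞 t) ∂ℏ := by
    have hc : ∀ G : Polynomial ℂ,
        Integrable (fun t => fourier (-(m : ℤ)) t * G.eval (𝐞 t)) ℏ := fun G =>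
      ((map_continuous (fourier (-(m : ℤ)))).mul
        (G.continuous.comp (map_continuous 𝐞))).integrable_haarAddCircle
    induction F using Polynomial.induction_on' with
    | add p q hp hq =>
      simp only [Polynomial.eval_add, mul_add, Polynomial.coeff_add]
      rw [integral_add (hc p) (hc q), hp, hq]
    | monomial k a =>
      have h1 := congrFun (fourierCoeff_fourier (T := 1) (k : ℤ)) (m : ℤ)
      rw [fourierCoeff] at h1
      simp only [smul_eq_mul] at h1
      have h2 : ∀ t : UnitAddCircle, fourier (-(m : ℤ)) t * (Polynomial.monomial k a).eval (𝐞 t) =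
          a * (fourier (-(m : ℤ)) t * fourier (k : ℤ) t) := by
        intro t
        rw [Polynomial.eval_monomial, fourier_one_pow]
        ring
      simp only [h2]
      rw [integral_const_mul, h1, Polynomial.coeff_monomial, Pi.single_apply]
      simp [eq_comm]
  rw [h]
  refine (norm_integral_le_integral_norm _).trans_eq ?_
  simp only [norm_mul, norm_fourier_apply, one_mul]

/-- **Cauchy's estimate** with respect to the `u`-th mean on the unit circle, `u > 0`. -/
lemma Polynomial.norm_coeff_rpow_le (F : Polynomial ℂ) (m : ℕ) {u : ℝ} (hu : 0 < u) {r : ℝ}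
    (hr0 : 0 ≤ r) (hr : r < 1) :
    (r ^ m * ‖F.coeff m‖) ^ u ≤ (1 + r) / (1 - r) * ∫ t, ‖F.eval (𝐞 t)‖ ^ u ∂ℏ := by
  set B := (1 + r) / (1 - r) * ∫ t, ‖F.eval (𝐞 t)‖ ^ u ∂ℏ with hB
  have hB0 : 0 ≤ B := mul_nonneg (div_nonneg (by linarith) (by linarith))
    (integral_nonneg fun t => by positivity)
  -- The estimate by the first mean is applied on the circle of radius r, where |F| is bounded by
  -- B^{1/u}. This avoids comparing u-th and first means, which is impossible directly when u < 1.
  have h1 := (F.comp (C (r : ℂ) * X)).norm_coeff_le_integral m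
  rw [comp_C_mul_X_coeff, norm_mul, norm_pow, Complex.norm_real, norm_of_nonneg hr0] at h1
  have h2 : ∫ t, ‖(F.comp (C (r : ℂ) * X)).eval (𝐞 t)‖ ∂ℏ ≤
      ∫ t : UnitAddCircle, B ^ (1 / u) ∂ℏ := by
    refine integral_mono_of_nonneg (ae_of_all _ fun t => norm_nonneg _) (integrable_const _)
      (ae_of_all _ fun t => ?_)
    have hw : ‖(r : ℂ) * 𝐞 t‖ = r := by
      rw [norm_mul, norm_fourier_apply, mul_one, Complex.norm_real, norm_of_nonneg hr0]
    have h3 := F.norm_eval_rpow_le hu (w := (r : ℂ) * 𝐞 t) (by rw [hw]; exact hr)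
    rw [hw, ← hB] at h3
    simp only [eval_comp, eval_mul, eval_C, eval_X]
    rwa [one_div, le_rpow_inv_iff_of_pos (norm_nonneg _) hB0 hu]
  rw [integral_const, probReal_univ, one_smul] at h2
  have h4 : r ^ m * ‖F.coeff m‖ ≤ B ^ (1 / u) := by rw [mul_comm]; exact h1.trans h2
  rwa [one_div, le_rpow_inv_iff_of_pos (by positivity) hB0 hu] at h4

end UnitCircle

/-! ### The torus, Bohr monomials and weighted degrees -/

section PrimeTorus

instance : IsProbabilityMeasure primeTorusMeasure :=
  inferInstanceAs (IsProbabilityMeasure (Measure.infinitePi _))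

/-- A translation acts coordinatewise, and each circle measure is invariant. -/
instance : primeTorusMeasure.IsAddRightInvariant where
  map_add_right_eq_self g := by
    have h := Measure.infinitePi_map_pi (fun _ : Nat.Primes => ℏ)
      (f := fun p x => x + g p) (fun p => by fun_prop)
    have h1 : ∀ p, Measure.map (fun x => x + g p) ℏ = ℏ := fun p => map_add_right_eq_self ℏ _
    simp only [h1] at h
    exact h

lemma Continuous.integrable_primeTorus {E : Type*} [NormedAddCommGroup E]
    {f : PrimeTorus → E} (hf : Continuous f) : Integrable f primeTorusMeasure :=
  hf.integrable_of_hasCompactSupport (HasCompactSupport.of_compactSpace f)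

/-- Averaging a continuous function over the translates by a one-parameter family does not change
its integral. -/
lemma integral_integral_add {f : PrimeTorus → ℝ} (hf : Continuous f)
    {γ : UnitAddCircle → PrimeTorus} (hγ : Continuous γ) :
    ∫ x, ∫ t, f (x + γ t) ∂ℏ ∂primeTorusMeasure = ∫ x, f x ∂primeTorusMeasure := by
  have hc : Continuous fun q : PrimeTorus × UnitAddCircle => f (q.1 + γ q.2) := by fun_prop
  rw [integral_integral_swap
    (hc.integrable_of_hasCompactSupport (HasCompactSupport.of_compactSpace _))]
  simp_rw [integral_add_right_eq_self]
  simp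

/-- The coordinate of a point of the torus which belongs to `p`, and `0` if `p` is not prime. -/
def coord (x : PrimeTorus) (p : ℕ) : UnitAddCircle :=
  if h : p.Prime then x (⟨p, h⟩ : Nat.Primes) else 0

lemma coord_coe (x : PrimeTorus) (p : Nat.Primes) : coord x (p : ℕ) = x p := dif_pos p.2

lemma coord_add (x y : PrimeTorus) (p : ℕ) : coord (x + y) p = coord x p + coord y p := by
  unfold coord
  split_ifs
  · rfl
  · simp

lemma continuous_coord (p : ℕ) : Continuous fun x => coord x p := by
  unfold coord
  split_ifs
  · exact continuous_apply _
  · exact continuous_const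

/-- In this form multiplicativity in n follows from additivity of `Nat.factorization`, and
continuity in x from that of finite products. -/
lemma bohrMonomial_eq_prod (n : ℕ+) (x : PrimeTorus) :
    bohrMonomial n x = (n : ℕ).factorization.prod fun p k => fourier (k : ℤ) (coord x p) := by
  classical
  set val : Nat.Primes → ℕ := fun p => p with hval
  have hinj : Function.Injective val := Nat.Primes.coe_nat_injective
  have hsub : Function.mulSupport (fun p : Nat.Primes =>
      fourier ((n : ℕ).factorization (p : ℕ) : ℤ) (x p)) ⊆
      (((n : ℕ).primeFactors.preimage val hinj.injOn : Finset Nat.Primes) : Set Nat.Primes) := by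
    intro p hp
    rw [Finset.mem_coe, Finset.mem_preimage, ← Nat.support_factorization, Finsupp.mem_support_iff]
    intro h0
    apply hp
    rw [hval] at h0
    simp only [h0, Nat.cast_zero, fourier_zero]
  rw [bohrMonomial, finprod_eq_prod_of_mulSupport_subset _ hsub, Finsupp.prod,
    Nat.support_factorization, ← Finset.prod_preimage val (n : ℕ).primeFactors hinj.injOn
      (fun p => fourier ((n : ℕ).factorization p : ℤ) (coord x p))]
  · exact Finset.prod_congr rfl fun p _ => by rw [hval, coord_coe]
  · intro p hp h
    exact absurd ⟨(⟨p, Nat.prime_of_mem_primeFactors hp⟩ : Nat.Primes), rfl⟩ h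

lemma fourier_add_apply (n : ℤ) (x y : UnitAddCircle) :
    fourier n (x + y) = fourier n x * fourier n y := by
  rw [fourier_apply, smul_add, AddCircle.toCircle_add]
  rfl

lemma bohrMonomial_add (n : ℕ+) (x y : PrimeTorus) :
    bohrMonomial n (x + y) = bohrMonomial n x * bohrMonomial n y := by
  simp only [bohrMonomial_eq_prod, Finsupp.prod, ← Finset.prod_mul_distrib, coord_add,
    fourier_add_apply]

lemma bohrMonomial_mul (m n : ℕ+) (x : PrimeTorus) :
    bohrMonomial (m * n) x = bohrMonomial m x * bohrMonomial n x := by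
  simp only [bohrMonomial_eq_prod]
  rw [PNat.mul_coe, Nat.factorization_mul m.ne_zero n.ne_zero]
  refine Finsupp.prod_add_index' (fun p => ?_) fun p k l => ?_
  · rw [Nat.cast_zero, fourier_zero]
  · rw [Nat.cast_add, fourier_add]

lemma bohrMonomial_one (x : PrimeTorus) : bohrMonomial 1 x = 1 := by
  simp [bohrMonomial_eq_prod]

lemma bohrMonomial_prime {p : ℕ+} (hp : (p : ℕ).Prime) (x : PrimeTorus) :
    bohrMonomial p x = 𝐞 (coord x p) := by
  rw [bohrMonomial_eq_prod, hp.factorization, Finsupp.prod_single_index, Nat.cast_one]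
  rw [Nat.cast_zero, fourier_zero]

lemma norm_bohrMonomial (n : ℕ+) (x : PrimeTorus) : ‖bohrMonomial n x‖ = 1 := by
  rw [bohrMonomial_eq_prod, Finsupp.prod, norm_prod]
  exact Finset.prod_eq_one fun p _ => norm_fourier_apply _ _

lemma continuous_bohrMonomial (n : ℕ+) : Continuous (bohrMonomial n) := by
  have h : bohrMonomial n = fun x => (n : ℕ).factorization.prod fun p k =>
      fourier (k : ℤ) (coord x p) := funext (bohrMonomial_eq_prod n)
  rw [h]
  exact continuous_finsetProd _ fun p _ => (map_continuous _).comp (continuous_coord p)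

/-- The weighted number `∑ ν_p(n) w(p)` of prime factors of `n`. -/
def weightedOmega (w : ℕ → ℕ) (n : ℕ+) : ℕ := (n : ℕ).factorization.sum fun p k => k * w p

lemma weightedOmega_mul (w : ℕ → ℕ) (m n : ℕ+) :
    weightedOmega w (m * n) = weightedOmega w m + weightedOmega w n := by
  simp only [weightedOmega]
  rw [PNat.mul_coe, Nat.factorization_mul m.ne_zero n.ne_zero]
  exact Finsupp.sum_add_index' (by simp) (fun p k l => add_mul _ _ _)

lemma weightedOmega_one (w : ℕ → ℕ) : weightedOmega w 1 = 0 := by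
  simp [weightedOmega]

lemma weightedOmega_prime (w : ℕ → ℕ) {p : ℕ+} (hp : (p : ℕ).Prime) :
    weightedOmega w p = w p := by
  rw [weightedOmega, hp.factorization, Finsupp.sum_single_index (zero_mul _), one_mul]

/-- The weight which counts only the prime `p`. -/
lemma weightedOmega_single (p : ℕ) (n : ℕ+) :
    weightedOmega (Pi.single p 1) n = (n : ℕ).factorization p := by
  rw [weightedOmega, Finsupp.sum]
  simp only [Pi.single_apply, mul_ite, mul_one, mul_zero]
  rw [Finset.sum_ite_eq' ]
  split_ifs with h
  · rfl
  · exact (Finsupp.notMem_support_iff.1 h).symm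

/-- The one-parameter subgroup `t ↦ (w(p) t)_p` of the torus. -/
def weightFlow (w : ℕ → ℕ) (t : UnitAddCircle) : PrimeTorus := fun p => w p • t

lemma continuous_weightFlow (w : ℕ → ℕ) : Continuous (weightFlow w) :=
  continuous_pi fun p => continuous_const_smul (w p)

lemma coord_weightFlow (w : ℕ → ℕ) {p : ℕ} (hp : p.Prime) (t : UnitAddCircle) :
    coord (weightFlow w t) p = w p • t := dif_pos hp

/-- Along the flow every monomial is a power of a single circle variable. This is what reduces
estimates on the torus to one-variable polynomials. -/
lemma bohrMonomial_weightFlow (w : ℕ → ℕ) (n : ℕ+) (t : UnitAddCircle) :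
    bohrMonomial n (weightFlow w t) = 𝐞 t ^ weightedOmega w n := by
  rw [bohrMonomial_eq_prod, weightedOmega, Finsupp.sum, ← Finset.prod_pow_eq_pow_sum, Finsupp.prod]
  refine Finset.prod_congr rfl fun p hp => ?_
  rw [Nat.support_factorization] at hp
  rw [coord_weightFlow w (Nat.prime_of_mem_primeFactors hp), fourier_one_pow,
    fourier_apply, fourier_apply, natCast_zsmul, natCast_zsmul, mul_smul]

end PrimeTorus

/-! ### Coefficient multipliers, slices, dilations and homogeneous projections -/

namespace DirichletPolynomial

/-- The polynomial `∑ c(n) a_n n^{-s}`. -/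
def multiplier (c : ℕ+ → ℂ) (P : DirichletPolynomial) : DirichletPolynomial :=
  Finsupp.onFinset P.support (fun n => c n * P n) fun n hn => by
    rw [Finsupp.mem_support_iff]
    exact right_ne_zero_of_mul hn

@[simp]
lemma multiplier_apply (c : ℕ+ → ℂ) (P : DirichletPolynomial) (n : ℕ+) :
    P.multiplier c n = c n * P n := rfl

lemma support_multiplier_subset (c : ℕ+ → ℂ) (P : DirichletPolynomial) :
    (P.multiplier c).support ⊆ P.support := Finsupp.support_onFinset_subset

lemma translate_eq_multiplier (σ : ℝ) (P : DirichletPolynomial) :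
    P.translate σ = P.multiplier fun n => (((n : ℕ) : ℝ) ^ (-σ) : ℝ) := by
  ext n
  simp [translate, mul_comm]

lemma multiplier_multiplier (c d : ℕ+ → ℂ) (P : DirichletPolynomial) :
    (P.multiplier d).multiplier c = P.multiplier fun n => c n * d n := by
  ext n
  simp [mul_assoc]

lemma multiplier_sub (c : ℕ+ → ℂ) (P Q : DirichletPolynomial) :
    (P - Q).multiplier c = P.multiplier c - Q.multiplier c := by
  ext n
  simp [mul_sub]

lemma bohrLift_eq_sum {P : DirichletPolynomial} {S : Finset ℕ+} (hS : P.support ⊆ S)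
    (x : PrimeTorus) : P.bohrLift x = ∑ n ∈ S, P n * bohrMonomial n x :=
  Finsupp.sum_of_support_subset _ hS _ fun _ _ => zero_mul _

lemma bohrLift_add (P Q : DirichletPolynomial) (x : PrimeTorus) :
    (P + Q).bohrLift x = P.bohrLift x + Q.bohrLift x :=
  Finsupp.sum_add_index' (fun _ => zero_mul _) fun _ _ _ => add_mul _ _ _

lemma bohrLift_smul (c : ℂ) (P : DirichletPolynomial) (x : PrimeTorus) :
    (c • P).bohrLift x = c * P.bohrLift x := by
  rw [bohrLift_eq_sum (S := P.support) Finsupp.support_smul, bohrLift_eq_sum subset_rfl,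
    Finset.mul_sum]
  simp [mul_assoc]

lemma bohrLift_single (n : ℕ+) (c : ℂ) (x : PrimeTorus) :
    bohrLift (Finsupp.single n c) x = c * bohrMonomial n x :=
  Finsupp.sum_single_index (zero_mul _)

lemma continuous_bohrLift (P : DirichletPolynomial) : Continuous P.bohrLift :=
  continuous_finsetSum _ fun n _ => continuous_const.mul (continuous_bohrMonomial n)

lemma norm_bohrLift_le {P : DirichletPolynomial} {S : Finset ℕ+} (hS : P.support ⊆ S)
    (x : PrimeTorus) : ‖P.bohrLift x‖ ≤ ∑ n ∈ S, ‖P n‖ := by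
  rw [bohrLift_eq_sum hS]
  refine (norm_sum_le _ _).trans_eq ?_
  simp [norm_bohrMonomial]

/-- The integral `∫ |𝓑 P|^p dm` whose `p`-th root is the Hardy (quasi-)norm. -/
def hardyIntegral (p : ℝ) (P : DirichletPolynomial) : ℝ :=
  ∫ x, ‖P.bohrLift x‖ ^ p ∂primeTorusMeasure

lemma hardyNorm_eq (p : ℝ) (P : DirichletPolynomial) :
    P.hardyNorm p = P.hardyIntegral p ^ (1 / p) := rfl

lemma hardyIntegral_nonneg (p : ℝ) (P : DirichletPolynomial) : 0 ≤ P.hardyIntegral p :=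
  integral_nonneg fun _ => by positivity

lemma hardyNorm_nonneg (p : ℝ) (P : DirichletPolynomial) : 0 ≤ P.hardyNorm p :=
  Real.rpow_nonneg (hardyIntegral_nonneg p P) _

lemma continuous_norm_bohrLift_rpow {p : ℝ} (hp : 0 < p) (P : DirichletPolynomial) :
    Continuous fun x => ‖P.bohrLift x‖ ^ p :=
  (continuous_bohrLift P).norm.rpow_const fun _ => Or.inr hp.le

lemma integrable_norm_bohrLift_rpow {p : ℝ} (hp : 0 < p) (P : DirichletPolynomial) :
    Integrable (fun x => ‖P.bohrLift x‖ ^ p) primeTorusMeasure :=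
  (continuous_norm_bohrLift_rpow hp P).integrable_primeTorus

/-- The polynomial `ζ ↦ ∑ a_n z^{ν(n)} ζ^{h(n)}`, where `h` is the weighted number of prime factors
and `z` is the point of the torus with coordinates `x`. -/
def slice (w : ℕ → ℕ) (P : DirichletPolynomial) (x : PrimeTorus) : Polynomial ℂ :=
  ∑ n ∈ P.support, Polynomial.monomial (weightedOmega w n) (P n * bohrMonomial n x)

lemma eval_slice (w : ℕ → ℕ) (P : DirichletPolynomial) (x : PrimeTorus) (ζ : ℂ) :
    (P.slice w x).eval ζ = (P.multiplier fun n => ζ ^ weightedOmega w n).bohrLift x := by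
  rw [bohrLift_eq_sum (support_multiplier_subset _ P), slice, Polynomial.eval_finsetSum]
  refine Finset.sum_congr rfl fun n _ => ?_
  rw [Polynomial.eval_monomial, multiplier_apply]
  ring

/-- On the circle a slice runs through a translate of the flow, so invariance of the measure turns
its means, averaged over x, into Hardy integrals. Its values inside the disc are dilations, and its
coefficients are homogeneous parts. -/
lemma eval_slice_fourier (w : ℕ → ℕ) (P : DirichletPolynomial) (x : PrimeTorus)
    (t : UnitAddCircle) : (P.slice w x).eval (𝐞 t) = P.bohrLift (x + weightFlow w t) := by
  rw [bohrLift_eq_sum subset_rfl, slice, Polynomial.eval_finsetSum]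
  refine Finset.sum_congr rfl fun n _ => ?_
  rw [Polynomial.eval_monomial, bohrMonomial_add, bohrMonomial_weightFlow, mul_assoc]

lemma coeff_slice (w : ℕ → ℕ) (P : DirichletPolynomial) (x : PrimeTorus) (m : ℕ) :
    (P.slice w x).coeff m =
      (P.multiplier fun n => if weightedOmega w n = m then 1 else 0).bohrLift x := by
  rw [bohrLift_eq_sum (support_multiplier_subset _ P), slice, Polynomial.finsetSum_coeff]
  refine Finset.sum_congr rfl fun n _ => ?_
  rw [Polynomial.coeff_monomial, multiplier_apply]
  split_ifs <;> simp

lemma integral_integral_slice (w : ℕ → ℕ) (P : DirichletPolynomial) {p : ℝ} (hp : 0 < p) :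
    ∫ x, ∫ t, ‖(P.slice w x).eval (𝐞 t)‖ ^ p ∂ℏ ∂primeTorusMeasure = P.hardyIntegral p := by
  simp only [eval_slice_fourier]
  exact integral_integral_add (continuous_norm_bohrLift_rpow hp P) (continuous_weightFlow w)

lemma continuous_integral_slice (w : ℕ → ℕ) (P : DirichletPolynomial) {p : ℝ} (hp : 0 < p)
    {g : UnitAddCircle → ℝ} (hg : Continuous g) :
    Continuous fun x => ∫ t, g t * ‖(P.slice w x).eval (𝐞 t)‖ ^ p ∂ℏ := by
  simp only [eval_slice_fourier]
  have h : Continuous (Function.uncurry fun (x : PrimeTorus) (t : UnitAddCircle) =>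
      g t * ‖P.bohrLift (x + weightFlow w t)‖ ^ p) :=
    (hg.comp continuous_snd).mul ((continuous_norm_bohrLift_rpow hp P).comp
      (continuous_fst.add ((continuous_weightFlow w).comp continuous_snd)))
  simpa using continuous_parametric_integral_of_continuous h (isCompact_univ) (μ := ℏ)

/-- Multiplying the variables by powers of a number in `[0, 1]` does not increase the Hardy
(quasi-)norm. -/
theorem hardyIntegral_multiplier_pow_le (w : ℕ → ℕ) (P : DirichletPolynomial) {p : ℝ} (hp : 0 < p)
    {r : ℝ} (hr0 : 0 ≤ r) (hr : r ≤ 1) :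
    (P.multiplier fun n => (r : ℂ) ^ weightedOmega w n).hardyIntegral p ≤ P.hardyIntegral p := by
  rcases hr.eq_or_lt with rfl | hr
  · refine le_of_eq (congrArg _ ?_)
    ext n
    simp
  have hr' : ‖(r : ℂ)‖ < 1 := by rwa [Complex.norm_real, Real.norm_of_nonneg hr0]
  have hP := continuous_circlePoisson hr'
  calc (P.multiplier fun n => (r : ℂ) ^ weightedOmega w n).hardyIntegral p
      ≤ ∫ x, ∫ t, circlePoisson r t * ‖(P.slice w x).eval (𝐞 t)‖ ^ p ∂ℏ ∂primeTorusMeasure := by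
        refine integral_mono (integrable_norm_bohrLift_rpow hp _)
          (continuous_integral_slice w P hp hP).integrable_primeTorus fun x => ?_
        simp only [← eval_slice]
        exact (P.slice w x).norm_eval_rpow_le_integral hp hr'
    -- After Fubini, translation invariance makes the inner integral a constant times the Poisson
    -- kernel, whose mass is 1.
    _ = ∫ t, ∫ x, circlePoisson r t * ‖P.bohrLift (x + weightFlow w t)‖ ^ p
          ∂primeTorusMeasure ∂ℏ := by
        simp only [eval_slice_fourier]
        refine integral_integral_swap (Continuous.integrable_of_hasCompactSupport ?_
          (HasCompactSupport.of_compactSpace _))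
        exact (hP.comp continuous_snd).mul ((continuous_norm_bohrLift_rpow hp P).comp
          (continuous_fst.add ((continuous_weightFlow w).comp continuous_snd)))
    _ = P.hardyIntegral p := by
        simp only [integral_const_mul]
        have h : ∀ t, ∫ x, ‖P.bohrLift (x + weightFlow w t)‖ ^ p ∂primeTorusMeasure =
            P.hardyIntegral p := fun t =>
          integral_add_right_eq_self (fun x => ‖P.bohrLift x‖ ^ p) _
        simp only [h]
        rw [integral_mul_const, integral_circlePoisson hr', one_mul]

/-- The projection onto the homogeneous part of degree `m` has a norm which grows more slowly than
any exponential. -/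
theorem hardyIntegral_homogeneous_le (w : ℕ → ℕ) (P : DirichletPolynomial) (m : ℕ) {p : ℝ}
    (hp : 0 < p) {r : ℝ} (hr0 : 0 ≤ r) (hr : r < 1) :
    (r ^ m) ^ p * (P.multiplier fun n => if weightedOmega w n = m then 1 else 0).hardyIntegral p ≤
      (1 + r) / (1 - r) * P.hardyIntegral p := by
  rw [← integral_integral_slice w P hp, hardyIntegral, ← integral_const_mul, ← integral_const_mul]
  have hc := continuous_integral_slice w P hp (g := fun _ => 1) continuous_const
  simp only [one_mul] at hc
  refine integral_mono ((integrable_norm_bohrLift_rpow hp _).const_mul _)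
    (hc.integrable_primeTorus.const_mul _) fun x => ?_
  have h := (P.slice w x).norm_coeff_rpow_le m hp hr0 hr
  rwa [coeff_slice, Real.mul_rpow (by positivity) (norm_nonneg _)] at h

/-- The homogeneous parts are bounded by the mean of the function. -/
theorem hardyIntegral_one_homogeneous_le (w : ℕ → ℕ) (P : DirichletPolynomial) (m : ℕ) :
    (P.multiplier fun n => if weightedOmega w n = m then 1 else 0).hardyIntegral 1 ≤
      P.hardyIntegral 1 := by
  rw [← integral_integral_slice w P one_pos, hardyIntegral]
  have hc := continuous_integral_slice w P one_pos (g := fun _ => 1) continuous_const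
  simp only [one_mul] at hc
  refine integral_mono (integrable_norm_bohrLift_rpow one_pos _)
    hc.integrable_primeTorus fun x => ?_
  have h := (P.slice w x).norm_coeff_le_integral m
  simpa only [coeff_slice, Real.rpow_one] using h

end DirichletPolynomial

/-! ### Contractivity of translations and quasi-norm inequalities -/

lemma Real.add_rpow_le_two_rpow_mul {a b p : ℝ} (ha : 0 ≤ a) (hb : 0 ≤ b) (hp : 0 ≤ p) :
    (a + b) ^ p ≤ 2 ^ p * (a ^ p + b ^ p) := by
  have h0 : (0 : ℝ) ≤ 2 ^ p := by positivity
  rcases le_total a b with h | h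
  · calc (a + b) ^ p ≤ (2 * b) ^ p := Real.rpow_le_rpow (by positivity) (by linarith) hp
      _ = 2 ^ p * b ^ p := Real.mul_rpow (by norm_num) hb
      _ ≤ _ := mul_le_mul_of_nonneg_left (by linarith [Real.rpow_nonneg ha p]) h0
  · calc (a + b) ^ p ≤ (2 * a) ^ p := Real.rpow_le_rpow (by positivity) (by linarith) hp
      _ = 2 ^ p * a ^ p := Real.mul_rpow (by norm_num) ha
      _ ≤ _ := mul_le_mul_of_nonneg_left (by linarith [Real.rpow_nonneg hb p]) h0

/-- Jensen's inequality for power functions on a probability space. -/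
lemma integral_rpow_le_integral_rpow {Ω : Type*} [MeasurableSpace Ω] {μ : Measure Ω}
    [IsProbabilityMeasure μ] {f : Ω → ℝ} (hf : ∀ x, 0 ≤ f x) {u p : ℝ} (hu : 0 < u) (hup : u ≤ p)
    (hfu : Integrable (fun x => f x ^ u) μ) (hfp : Integrable (fun x => f x ^ p) μ) :
    (∫ x, f x ^ u ∂μ) ^ (1 / u) ≤ (∫ x, f x ^ p ∂μ) ^ (1 / p) := by
  have hp : 0 < p := hu.trans_le hup
  have e : ∀ x, (f x ^ u) ^ (p / u) = f x ^ p := fun x => by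
    rw [← Real.rpow_mul (hf x), mul_div_cancel₀ _ hu.ne']
  have h := (convexOn_rpow (p := p / u) ((one_le_div hu).2 hup)).map_integral_le (μ := μ)
    (f := fun x => f x ^ u)
    (Real.continuous_rpow_const (by positivity)).continuousOn isClosed_Ici
    (ae_of_all _ fun x => Real.rpow_nonneg (hf x) u) hfu (by
      simpa only [Function.comp_def, e] using hfp)
  simp only [e] at h
  have h0 : 0 ≤ ∫ x, f x ^ u ∂μ := integral_nonneg fun x => Real.rpow_nonneg (hf x) u
  calc (∫ x, f x ^ u ∂μ) ^ (1 / u) = ((∫ x, f x ^ u ∂μ) ^ (p / u)) ^ (1 / p) := by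
        rw [← Real.rpow_mul h0]; congr 1; field_simp
    _ ≤ _ := Real.rpow_le_rpow (by positivity) h (by positivity)

namespace DirichletPolynomial

lemma multiplier_congr {c d : ℕ+ → ℂ} {P : DirichletPolynomial}
    (h : ∀ n ∈ P.support, c n = d n) : P.multiplier c = P.multiplier d := by
  ext n
  rw [multiplier_apply, multiplier_apply]
  by_cases hn : n ∈ P.support
  · rw [h n hn]
  · rw [Finsupp.notMem_support_iff.1 hn, mul_zero, mul_zero]

/-- Multiplying finitely many variables by numbers in `[0, 1]` does not increase the Hardy
(quasi-)norm. -/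
theorem hardyIntegral_multiplier_prod_le (T : Finset ℕ) {s : ℕ → ℝ} (hs0 : ∀ p ∈ T, 0 ≤ s p)
    (hs1 : ∀ p ∈ T, s p ≤ 1) (P : DirichletPolynomial) {u : ℝ} (hu : 0 < u) :
    (P.multiplier fun n => ∏ p ∈ T, (s p : ℂ) ^ (n : ℕ).factorization p).hardyIntegral u ≤
      P.hardyIntegral u := by
  classical
  induction T using Finset.induction_on with
  | empty =>
    refine le_of_eq (congrArg _ ?_)
    ext n
    simp
  | insert p T hp ih =>
    refine le_trans ?_ (ih (fun q hq => hs0 q (Finset.mem_insert_of_mem hq))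
      fun q hq => hs1 q (Finset.mem_insert_of_mem hq))
    have h := hardyIntegral_multiplier_pow_le (Pi.single p 1)
      (P.multiplier fun n => ∏ p ∈ T, (s p : ℂ) ^ (n : ℕ).factorization p) hu
      (hs0 p (Finset.mem_insert_self _ _)) (hs1 p (Finset.mem_insert_self _ _))
    rw [multiplier_multiplier] at h
    simpa only [Finset.prod_insert hp, weightedOmega_single] using h

lemma natCast_rpow_eq_prod (σ : ℝ) {n : ℕ} (hn : n ≠ 0) {T : Finset ℕ} (hT : n.primeFactors ⊆ T) :
    (n : ℝ) ^ σ = ∏ p ∈ T, ((p : ℝ) ^ σ) ^ n.factorization p := by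
  have hT' : n.factorization.support ⊆ T := by rwa [Nat.support_factorization]
  conv_lhs => rw [← Nat.prod_factorization_pow_eq_self hn]
  rw [Finsupp.prod_of_support_subset _ hT' _ fun p _ => pow_zero p,
    Nat.cast_prod, ← Real.finsetProd_rpow _ _ fun p _ => by positivity]
  refine Finset.prod_congr rfl fun p _ => ?_
  rw [Nat.cast_pow, ← Real.rpow_natCast, ← Real.rpow_mul (by positivity), mul_comm,
    Real.rpow_mul (by positivity), Real.rpow_natCast]

/-- Horizontal translation to the right does not increase the Hardy (quasi-)norm. -/
theorem hardyIntegral_translate_le {σ : ℝ} (hσ : 0 ≤ σ) (P : DirichletPolynomial) {u : ℝ}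
    (hu : 0 < u) : (P.translate σ).hardyIntegral u ≤ P.hardyIntegral u := by
  classical
  -- Only finitely many primes matter, and n^{-σ} is the product of (p^{-σ})^{ν_p(n)} over them,
  -- with each p^{-σ} in [0, 1].
  set T := P.support.biUnion fun n => (n : ℕ).primeFactors with hT
  have h := hardyIntegral_multiplier_prod_le T (s := fun p => (p : ℝ) ^ (-σ))
    (fun p _ => by positivity) (fun p hp => ?_) P hu
  · rw [translate_eq_multiplier]
    convert h using 2
    refine multiplier_congr fun n hn => ?_
    rw [natCast_rpow_eq_prod (-σ) n.ne_zero
      (Finset.subset_biUnion_of_mem (fun n : ℕ+ => (n : ℕ).primeFactors) hn)]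
    push_cast
    rfl
  · obtain ⟨n, -, hn⟩ := Finset.mem_biUnion.1 hp
    refine Real.rpow_le_one_of_one_le_of_nonpos ?_ (by linarith)
    exact_mod_cast (Nat.prime_of_mem_primeFactors hn).one_le

lemma hardyNorm_translate_le {σ : ℝ} (hσ : 0 ≤ σ) (P : DirichletPolynomial) {u : ℝ}
    (hu : 0 < u) : (P.translate σ).hardyNorm u ≤ P.hardyNorm u :=
  Real.rpow_le_rpow (hardyIntegral_nonneg _ _) (hardyIntegral_translate_le hσ P hu) (by positivity)

lemma hardyNorm_le_hardyNorm {u p : ℝ} (hu : 0 < u) (hup : u ≤ p) (P : DirichletPolynomial) :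
    P.hardyNorm u ≤ P.hardyNorm p :=
  integral_rpow_le_integral_rpow (fun _ => norm_nonneg _) hu hup
    (integrable_norm_bohrLift_rpow hu P) (integrable_norm_bohrLift_rpow (hu.trans_le hup) P)

lemma hardyIntegral_add_le {p : ℝ} (hp : 0 < p) (P Q : DirichletPolynomial) :
    (P + Q).hardyIntegral p ≤ 2 ^ p * (P.hardyIntegral p + Q.hardyIntegral p) := by
  have h1 := integrable_norm_bohrLift_rpow hp P
  have h2 := integrable_norm_bohrLift_rpow hp Q
  rw [hardyIntegral, hardyIntegral, hardyIntegral, ← integral_add h1 h2, ← integral_const_mul]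
  refine integral_mono (integrable_norm_bohrLift_rpow hp _) ((h1.add h2).const_mul _) fun x => ?_
  rw [bohrLift_add]
  exact (Real.rpow_le_rpow (norm_nonneg _) (norm_add_le _ _) hp.le).trans
    (Real.add_rpow_le_two_rpow_mul (norm_nonneg _) (norm_nonneg _) hp.le)

lemma hardyIntegral_smul {p : ℝ} (c : ℂ) (P : DirichletPolynomial) :
    (c • P).hardyIntegral p = ‖c‖ ^ p * P.hardyIntegral p := by
  rw [hardyIntegral, hardyIntegral, ← integral_const_mul]
  refine integral_congr_ae (ae_of_all _ fun x => ?_)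
  simp only [bohrLift_smul, norm_mul]
  exact Real.mul_rpow (norm_nonneg _) (norm_nonneg _)

lemma hardyIntegral_neg {p : ℝ} (P : DirichletPolynomial) :
    (-P).hardyIntegral p = P.hardyIntegral p := by
  rw [← neg_one_smul ℂ P, hardyIntegral_smul]
  simp

lemma hardyIntegral_le_of_norm_le {p B : ℝ} (hp : 0 < p) {P : DirichletPolynomial}
    (h : ∀ x, ‖P.bohrLift x‖ ≤ B) : P.hardyIntegral p ≤ B ^ p := by
  have : P.hardyIntegral p ≤ ∫ _, B ^ p ∂primeTorusMeasure :=
    integral_mono (integrable_norm_bohrLift_rpow hp P) (integrable_const _) fun x =>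
      Real.rpow_le_rpow (norm_nonneg _) (h x) hp.le
  simpa using this

lemma hardyNorm_le_of_norm_le {p B : ℝ} (hp : 0 < p) (hB : 0 ≤ B) {P : DirichletPolynomial}
    (h : ∀ x, ‖P.bohrLift x‖ ≤ B) : P.hardyNorm p ≤ B := by
  rw [hardyNorm_eq, one_div, Real.rpow_inv_le_iff_of_pos (hardyIntegral_nonneg _ _) hB hp]
  exact hardyIntegral_le_of_norm_le hp h

lemma hardyNorm_lt_iff {p ε : ℝ} (hp : 0 < p) (hε : 0 ≤ ε) {P : DirichletPolynomial} :
    P.hardyNorm p < ε ↔ P.hardyIntegral p < ε ^ p := by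
  rw [hardyNorm_eq, one_div, Real.rpow_inv_lt_iff_of_pos (hardyIntegral_nonneg _ _) hε hp]

lemma continuous_hardyNorm_translate {u : ℝ} (hu : 0 < u) (P : DirichletPolynomial) :
    Continuous fun σ => (P.translate σ).hardyNorm u := by
  have h : Continuous (Function.uncurry fun (σ : ℝ) (x : PrimeTorus) =>
      ‖(P.translate σ).bohrLift x‖ ^ u) := by
    have e : ∀ (σ : ℝ) (x : PrimeTorus), (P.translate σ).bohrLift x =
        ∑ n ∈ P.support, P n * (((n : ℕ) : ℝ) ^ (-σ) : ℝ) * bohrMonomial n x := fun σ x => by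
      rw [bohrLift_eq_sum (S := P.support)]
      · rfl
      · exact Finsupp.support_onFinset_subset
    simp only [e]
    refine Continuous.rpow_const (Continuous.norm ?_) fun _ => Or.inr hu.le
    refine continuous_finsetSum _ fun n _ => ?_
    refine (continuous_const.mul (Complex.continuous_ofReal.comp ?_)).mul
      ((continuous_bohrMonomial n).comp continuous_snd)
    refine continuous_const.rpow (continuous_fst.neg) fun _ => Or.inl ?_
    exact_mod_cast n.ne_zero
  have h2 := continuous_parametric_integral_of_continuous h isCompact_univ
    (μ := primeTorusMeasure)
  simp only [Measure.restrict_univ] at h2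
  exact h2.rpow_const fun _ => Or.inr (by positivity)

end DirichletPolynomial

/-! ### The measure μ_α -/

section MuMeasure

lemma muMeasure_density_nonneg {α : ℝ} (hα : -1 < α) {σ : ℝ} (hσ : 0 < σ) :
    0 ≤ 2 ^ (α + 1) / Real.Gamma (α + 1) * σ ^ α * Real.exp (-2 * σ) := by
  have : 0 < Real.Gamma (α + 1) := Real.Gamma_pos_of_pos (by linarith)
  positivity

lemma measurable_muMeasure_density (α : ℝ) : Measurable fun σ : ℝ => ENNReal.ofReal
    (2 ^ (α + 1) / Real.Gamma (α + 1) * σ ^ α * Real.exp (-2 * σ)) := by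
  fun_prop

lemma ae_pos_muMeasure (α : ℝ) : ∀ᵐ σ ∂muMeasure α, 0 < σ := by
  refine (withDensity_absolutelyContinuous _ _).ae_le ?_
  exact ae_restrict_mem measurableSet_Ioi

/-- The condition on α + β is integrability at 0; the exponential factor takes care of infinity. -/
lemma integrable_muMeasure_rpow {α β : ℝ} (hα : -1 < α) (hβ : -1 < α + β) :
    Integrable (fun σ => σ ^ β) (muMeasure α) := by
  rw [muMeasure, integrable_withDensity_iff (measurable_muMeasure_density α)
    (ae_of_all _ fun _ => ENNReal.ofReal_lt_top)]
  have h : IntegrableOn (fun σ : ℝ => 2 ^ (α + 1) / Real.Gamma (α + 1) *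
      (σ ^ (α + β) * Real.exp (-2 * σ))) (Set.Ioi 0) := by
    refine Integrable.const_mul ?_ _
    have h := integrableOn_rpow_mul_exp_neg_mul_rpow hβ one_pos two_pos
    simp only [Real.rpow_one] at h
    exact h
  refine h.congr ?_
  filter_upwards [ae_restrict_mem measurableSet_Ioi] with σ hσ
  rw [ENNReal.toReal_ofReal (muMeasure_density_nonneg hα hσ), Real.rpow_add hσ]
  ring

lemma isFiniteMeasure_muMeasure {α : ℝ} (hα : -1 < α) : IsFiniteMeasure (muMeasure α) := by
  have h := integrable_muMeasure_rpow (β := 0) hα (by linarith)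
  simp only [Real.rpow_zero] at h
  exact (integrable_const_iff_isFiniteMeasure one_ne_zero).1 h

end MuMeasure

/-! ### The mixed quasi-norm -/

namespace DirichletPolynomial

/-- The integral `∫ ‖P_σ‖^v dμ_α(σ)` whose `v`-th root is the mixed (quasi-)norm. -/
def mixedIntegral (u v α : ℝ) (P : DirichletPolynomial) : ℝ :=
  ∫ σ, (P.translate σ).hardyNorm u ^ v ∂muMeasure α

lemma mixedNorm_eq (u v α : ℝ) (P : DirichletPolynomial) :
    P.mixedNorm u v α = P.mixedIntegral u v α ^ (1 / v) := rfl

lemma mixedIntegral_nonneg (u v α : ℝ) (P : DirichletPolynomial) : 0 ≤ P.mixedIntegral u v α :=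
  integral_nonneg fun _ => Real.rpow_nonneg (hardyNorm_nonneg _ _) _

lemma mixedNorm_lt_iff {u v α ε : ℝ} (hv : 0 < v) (hε : 0 ≤ ε) {P : DirichletPolynomial} :
    P.mixedNorm u v α < ε ↔ P.mixedIntegral u v α < ε ^ v := by
  rw [mixedNorm_eq, one_div, Real.rpow_inv_lt_iff_of_pos (mixedIntegral_nonneg _ _ _ _) hε hv]

lemma integrable_hardyNorm_translate_rpow {u v α : ℝ} (hu : 0 < u) (hv : 0 < v) (hα : -1 < α)
    (P : DirichletPolynomial) :
    Integrable (fun σ => (P.translate σ).hardyNorm u ^ v) (muMeasure α) := by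
  have := isFiniteMeasure_muMeasure hα
  have hc : Continuous fun σ => (P.translate σ).hardyNorm u ^ v :=
    (continuous_hardyNorm_translate hu P).rpow_const fun _ => Or.inr hv.le
  refine Integrable.mono' (integrable_const (P.hardyNorm u ^ v)) hc.aestronglyMeasurable ?_
  filter_upwards [ae_pos_muMeasure α] with σ hσ
  have h0 := hardyNorm_nonneg u (P.translate σ)
  rw [Real.norm_of_nonneg (by positivity)]
  exact Real.rpow_le_rpow h0 (hardyNorm_translate_le hσ.le P hu) hv.le

lemma mixedIntegral_le_of_hardyNorm_le {u v α B : ℝ} (hu : 0 < u) (hv : 0 < v) (hα : -1 < α)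
    {P : DirichletPolynomial} (h : P.hardyNorm u ≤ B) :
    P.mixedIntegral u v α ≤ (muMeasure α).real Set.univ * B ^ v := by
  have := isFiniteMeasure_muMeasure hα
  have h1 : P.mixedIntegral u v α ≤ ∫ _, B ^ v ∂muMeasure α := by
    refine integral_mono_ae (integrable_hardyNorm_translate_rpow hu hv hα P) (integrable_const _) ?_
    filter_upwards [ae_pos_muMeasure α] with σ hσ
    exact Real.rpow_le_rpow (hardyNorm_nonneg _ _) ((hardyNorm_translate_le hσ.le P hu).trans h)
      hv.le
  simpa using h1

lemma hardyNorm_add_rpow_le {u v : ℝ} (hu : 0 < u) (hv : 0 < v) (P Q : DirichletPolynomial) :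
    (P + Q).hardyNorm u ^ v ≤
      (2 * 2 ^ (1 / u)) ^ v * 2 ^ v * (P.hardyNorm u ^ v + Q.hardyNorm u ^ v) := by
  have hP := hardyNorm_nonneg u P
  have hQ := hardyNorm_nonneg u Q
  have hP' := hardyIntegral_nonneg u P
  have hQ' := hardyIntegral_nonneg u Q
  have h1 : (P + Q).hardyNorm u ≤ 2 * 2 ^ (1 / u) * (P.hardyNorm u + Q.hardyNorm u) := by
    calc (P + Q).hardyNorm u
        ≤ (2 ^ u * (P.hardyIntegral u + Q.hardyIntegral u)) ^ (1 / u) :=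
          Real.rpow_le_rpow (hardyIntegral_nonneg _ _) (hardyIntegral_add_le hu P Q)
            (by positivity)
      _ = 2 * (P.hardyIntegral u + Q.hardyIntegral u) ^ (1 / u) := by
          rw [Real.mul_rpow (by positivity) (by positivity), ← Real.rpow_mul (by positivity),
            mul_one_div_cancel hu.ne', Real.rpow_one]
      _ ≤ 2 * (2 ^ (1 / u) * (P.hardyIntegral u ^ (1 / u) + Q.hardyIntegral u ^ (1 / u))) :=
          mul_le_mul_of_nonneg_left (Real.add_rpow_le_two_rpow_mul hP' hQ' (by positivity))
            (by norm_num)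
      _ = _ := by rw [← hardyNorm_eq, ← hardyNorm_eq]; ring
  calc (P + Q).hardyNorm u ^ v
      ≤ (2 * 2 ^ (1 / u) * (P.hardyNorm u + Q.hardyNorm u)) ^ v :=
        Real.rpow_le_rpow (hardyNorm_nonneg _ _) h1 hv.le
    _ = (2 * 2 ^ (1 / u)) ^ v * (P.hardyNorm u + Q.hardyNorm u) ^ v :=
        Real.mul_rpow (by positivity) (by positivity)
    _ ≤ (2 * 2 ^ (1 / u)) ^ v * (2 ^ v * (P.hardyNorm u ^ v + Q.hardyNorm u ^ v)) :=
        mul_le_mul_of_nonneg_left (Real.add_rpow_le_two_rpow_mul hP hQ hv.le) (by positivity)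
    _ = _ := by ring

lemma hardyNorm_smul {u : ℝ} (hu : 0 < u) (c : ℂ) (P : DirichletPolynomial) :
    (c • P).hardyNorm u = ‖c‖ * P.hardyNorm u := by
  rw [hardyNorm_eq, hardyNorm_eq, hardyIntegral_smul, Real.mul_rpow (by positivity)
    (hardyIntegral_nonneg _ _), ← Real.rpow_mul (norm_nonneg _), mul_one_div_cancel hu.ne',
    Real.rpow_one]

lemma translate_smul (σ : ℝ) (c : ℂ) (P : DirichletPolynomial) :
    (c • P).translate σ = c • P.translate σ := by
  ext n
  simp [translate, mul_assoc]

lemma mixedIntegral_neg {u v α : ℝ} (P : DirichletPolynomial) :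
    (-P).mixedIntegral u v α = P.mixedIntegral u v α := by
  rw [← neg_one_smul ℂ P, mixedIntegral, mixedIntegral]
  simp only [translate_smul, hardyNorm_eq, hardyIntegral_smul, norm_neg, norm_one, Real.one_rpow,
    one_mul]

lemma translate_add (σ : ℝ) (P Q : DirichletPolynomial) :
    (P + Q).translate σ = P.translate σ + Q.translate σ := by
  ext n
  simp [translate, add_mul]

/-- A constant independent of P and Q is all that is needed in place of the triangle inequality, for
instance to see that Cauchy sequences are bounded. -/
lemma exists_mixedIntegral_add_le {u v α : ℝ} (hu : 0 < u) (hv : 0 < v) (hα : -1 < α) :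
    ∃ C : ℝ, 0 < C ∧ ∀ P Q : DirichletPolynomial,
      (P + Q).mixedIntegral u v α ≤ C * (P.mixedIntegral u v α + Q.mixedIntegral u v α) := by
  refine ⟨(2 * 2 ^ (1 / u)) ^ v * 2 ^ v, by positivity, fun P Q => ?_⟩
  have h1 := integrable_hardyNorm_translate_rpow hu hv hα P
  have h2 := integrable_hardyNorm_translate_rpow hu hv hα Q
  rw [mixedIntegral, mixedIntegral, mixedIntegral, ← integral_add h1 h2, ← integral_const_mul]
  refine integral_mono (integrable_hardyNorm_translate_rpow hu hv hα _) ((h1.add h2).const_mul _)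
    fun σ => ?_
  rw [translate_add]
  exact hardyNorm_add_rpow_le hu hv _ _

end DirichletPolynomial

/-! ### Inclusions for u ≤ p -/

theorem hardySpace_subset_hardySpace {u p : ℝ} (hu : 0 < u) (hup : u ≤ p) :
    hardySpace p ⊆ hardySpace u := by
  rintro a ⟨ha, P, hP, hlim⟩
  refine ⟨ha, P, fun ε hε => ?_, hlim⟩
  obtain ⟨K, hK⟩ := hP ε hε
  exact ⟨K, fun j k hj hk =>
    (DirichletPolynomial.hardyNorm_le_hardyNorm hu hup _).trans_lt (hK j k hj hk)⟩

theorem hardySpace_subset_mixedNormSpace_of_le {p u v α : ℝ} (hu : 0 < u) (hv : 0 < v)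
    (hα : -1 < α) (hup : u ≤ p) : hardySpace p ⊆ mixedNormSpace u v α := by
  rintro a ⟨ha, P, hP, hlim⟩
  refine ⟨ha, P, fun ε hε => ?_, hlim⟩
  set M := (muMeasure α).real Set.univ
  have hM : 0 ≤ M := measureReal_nonneg
  -- The total mass M contributes M^{1/v}; using M + 1 keeps the denominator positive and the final
  -- inequality strict.
  obtain ⟨K, hK⟩ := hP (ε / (M + 1) ^ (1 / v)) (by positivity)
  refine ⟨K, fun j k hj hk => ?_⟩
  rw [DirichletPolynomial.mixedNorm_lt_iff hv hε.le]
  have h := DirichletPolynomial.mixedIntegral_le_of_hardyNorm_le hu hv hα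
    ((DirichletPolynomial.hardyNorm_le_hardyNorm hu hup _).trans (hK j k hj hk).le)
  refine h.trans_lt ?_
  rw [Real.div_rpow hε.le (by positivity), ← Real.rpow_mul (by positivity),
    one_div_mul_cancel hv.ne', Real.rpow_one, mul_div_assoc', div_lt_iff₀ (by positivity),
    mul_comm]
  exact mul_lt_mul_of_pos_left (by linarith) (by positivity)

/-! ### Convergence on half-planes; the lacunary series in the mixed norm spaces -/

/-- A Dirichlet series whose coefficients grow at most linearly converges on a half-plane. -/
lemma mem_convergentDirichletSeries_of_le {a : DirichletSeries} {C : ℝ}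
    (ha : ∀ n : ℕ+, ‖a n‖ ≤ C * (n : ℕ)) : a ∈ convergentDirichletSeries := by
  -- The terms are at most C n^{1 - Re s}, which is summable for Re s > 2.
  refine ⟨2, fun s hs => ?_⟩
  have hsum : Summable fun n : ℕ => a n.succPNat * ((n.succPNat : ℕ) : ℂ) ^ (-s) := by
    refine Summable.of_norm_bounded
      (g := fun n : ℕ => C * (((n + 1 : ℕ) : ℝ) ^ (1 - s.re))) ?_ fun n => ?_
    · refine Summable.mul_left C ?_
      exact (summable_nat_add_iff 1 (f := fun n : ℕ => (n : ℝ) ^ (1 - s.re))).2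
        (Real.summable_nat_rpow.2 (by linarith))
    · have hn : (0 : ℝ) < ((n + 1 : ℕ) : ℝ) := by positivity
      rw [norm_mul, Complex.norm_natCast_cpow_of_pos n.succPNat.pos, Complex.neg_re,
        Nat.succPNat_coe, Nat.succ_eq_add_one, sub_eq_add_neg, Real.rpow_add hn, Real.rpow_one,
        ← mul_assoc]
      exact mul_le_mul_of_nonneg_right (ha n.succPNat) (by positivity)
  exact ⟨_, hsum.hasSum.tendsto_sum_nat⟩

/-- The partial sums of the lacunary series. -/
def lacunaryPolynomial (K : ℕ) : DirichletPolynomial :=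
  ∑ k ∈ Finset.range K, Finsupp.single (2 ^ 2 ^ k : ℕ+) 1

lemma PNat.two_pow_injective : Function.Injective fun k : ℕ => (2 ^ k : ℕ+) := by
  intro a b h
  have h' := congrArg ((↑) : ℕ+ → ℕ) h
  simp only [PNat.pow_coe] at h'
  exact Nat.pow_right_injective (le_refl 2) h'

lemma PNat.two_pow_two_pow_injective : Function.Injective fun k : ℕ => (2 ^ 2 ^ k : ℕ+) :=
  PNat.two_pow_injective.comp (Nat.pow_right_injective (le_refl 2))

lemma lacunarySeries_two_pow_two_pow (k : ℕ) : lacunarySeries (2 ^ 2 ^ k) = 1 :=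
  if_pos ⟨k, by simp⟩

lemma lacunarySeries_eq_zero {n : ℕ+} (hn : ∀ k : ℕ, n ≠ 2 ^ 2 ^ k) : lacunarySeries n = 0 := by
  refine if_neg ?_
  rintro ⟨k, hk⟩
  exact hn k (PNat.eq (by simpa using hk))

lemma norm_lacunarySeries_le (n : ℕ+) : ‖lacunarySeries n‖ ≤ 1 := by
  unfold lacunarySeries
  split_ifs <;> simp

lemma lacunaryPolynomial_apply (K : ℕ) (n : ℕ+) :
    lacunaryPolynomial K n = ∑ k ∈ Finset.range K, if (2 ^ 2 ^ k : ℕ+) = n then 1 else 0 := by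
  rw [lacunaryPolynomial, Finsupp.finsetSum_apply]
  exact Finset.sum_congr rfl fun k _ => Finsupp.single_apply

lemma tendsto_lacunaryPolynomial (n : ℕ+) :
    Tendsto (fun K => lacunaryPolynomial K n) atTop (𝓝 (lacunarySeries n)) := by
  simp only [lacunaryPolynomial_apply]
  by_cases h : ∃ k : ℕ, n = 2 ^ 2 ^ k
  · obtain ⟨k, rfl⟩ := h
    rw [lacunarySeries_two_pow_two_pow]
    refine tendsto_const_nhds.congr' ?_
    filter_upwards [eventually_gt_atTop k] with K hK
    have : ∀ i : ℕ, ((2 ^ 2 ^ i : ℕ+) = 2 ^ 2 ^ k) ↔ i = k := fun i =>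
      PNat.two_pow_two_pow_injective.eq_iff
    simp only [this]
    rw [Finset.sum_ite_eq' , if_pos (Finset.mem_range.2 hK)]
  · push Not at h
    rw [lacunarySeries_eq_zero h]
    refine tendsto_const_nhds.congr fun K => ?_
    exact (Finset.sum_eq_zero fun k _ => if_neg (h k).symm).symm

lemma norm_bohrLift_translate_lacunaryPolynomial_sub_le {k j : ℕ} (hkj : k ≤ j) (σ : ℝ)
    (x : PrimeTorus) :
    ‖((lacunaryPolynomial j - lacunaryPolynomial k).translate σ).bohrLift x‖ ≤
      ∑ i ∈ Finset.Ico k j, ((2 : ℝ) ^ 2 ^ i) ^ (-σ) := by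
  have e : (lacunaryPolynomial j - lacunaryPolynomial k).translate σ =
      ∑ i ∈ Finset.Ico k j,
        Finsupp.single (2 ^ 2 ^ i : ℕ+) ((((2 : ℝ) ^ 2 ^ i) ^ (-σ) : ℝ) : ℂ) := by
    ext n
    rw [lacunaryPolynomial, lacunaryPolynomial, ← Finset.sum_Ico_eq_sub _ hkj,
      DirichletPolynomial.translate_eq_multiplier, DirichletPolynomial.multiplier_apply,
      Finsupp.finsetSum_apply, Finsupp.finsetSum_apply, Finset.mul_sum]
    refine Finset.sum_congr rfl fun i _ => ?_
    rw [Finsupp.single_apply, Finsupp.single_apply]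
    split_ifs with h
    · rw [← h]; simp
    · simp
  have h0 : ∀ s : Finset ℕ, (∑ i ∈ s,
      Finsupp.single (2 ^ 2 ^ i : ℕ+) ((((2 : ℝ) ^ 2 ^ i) ^ (-σ) : ℝ) : ℂ) :
        DirichletPolynomial).bohrLift x =
      ∑ i ∈ s, ((((2 : ℝ) ^ 2 ^ i) ^ (-σ) : ℝ) : ℂ) * bohrMonomial (2 ^ 2 ^ i) x := by
    intro s
    induction s using Finset.cons_induction with
    | empty => simp [DirichletPolynomial.bohrLift]
    | cons i s hi ih =>
      rw [Finset.sum_cons, Finset.sum_cons, DirichletPolynomial.bohrLift_add, ih,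
        DirichletPolynomial.bohrLift_single]
  rw [e, h0]
  refine (norm_sum_le _ _).trans_eq (Finset.sum_congr rfl fun i _ => ?_)
  rw [norm_mul, norm_bohrMonomial, mul_one, Complex.norm_real, Real.norm_of_nonneg (by positivity)]

/-- From y/ε ≤ e^{y/ε} one gets e^{-y} ≤ (ε/y)^ε, used with y = σ 2^i log 2. The result is geometric
in i, at the price of only σ^{-ε}. -/
lemma two_pow_two_pow_rpow_le {ε σ : ℝ} (hε : 0 < ε) (hσ : 0 < σ) (i : ℕ) :
    ((2 : ℝ) ^ 2 ^ i) ^ (-σ) ≤ (ε / Real.log 2) ^ ε * σ ^ (-ε) * ((2 : ℝ) ^ (-ε)) ^ i := by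
  have hl : 0 < Real.log 2 := Real.log_pos one_lt_two
  set y := σ * 2 ^ i * Real.log 2 with hy
  have hy0 : 0 < y := by positivity
  have h1 : ((2 : ℝ) ^ 2 ^ i) ^ (-σ) = Real.exp (-y) := by
    rw [Real.rpow_def_of_pos (by positivity), Real.log_pow, hy]
    push_cast
    ring_nf
  have h2 : (y / ε) ^ ε ≤ Real.exp y := by
    calc (y / ε) ^ ε ≤ Real.exp (y / ε) ^ ε := by
          refine Real.rpow_le_rpow (by positivity) ?_ hε.le
          linarith [Real.add_one_le_exp (y / ε)]
      _ = Real.exp y := by rw [← Real.exp_mul, div_mul_cancel₀ _ hε.ne']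
  have h3 : (ε / Real.log 2) ^ ε * σ ^ (-ε) * ((2 : ℝ) ^ (-ε)) ^ i = ((y / ε) ^ ε)⁻¹ := by
    rw [← Real.rpow_natCast, ← Real.rpow_mul zero_le_two, mul_comm (-ε), Real.rpow_mul zero_le_two,
      Real.rpow_natCast, Real.rpow_neg hσ.le, Real.rpow_neg (by positivity),
      ← Real.inv_rpow hσ.le, ← Real.inv_rpow (by positivity), ← Real.inv_rpow (by positivity),
      ← Real.mul_rpow (by positivity) (by positivity), ← Real.mul_rpow (by positivity)
      (by positivity)]
    congr 1
    rw [hy]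
    field_simp
  rw [h1, h3, Real.exp_neg]
  exact inv_anti₀ (by positivity) h2

theorem lacunarySeries_mem_mixedNormSpace {u v α : ℝ} (hu : 0 < u) (hv : 0 < v) (hα : -1 < α) :
    lacunarySeries ∈ mixedNormSpace u v α := by
  refine ⟨mem_convergentDirichletSeries_of_le (C := 1) fun n => ?_, lacunaryPolynomial, ?_,
    tendsto_lacunaryPolynomial⟩
  · rw [one_mul]
    exact (norm_lacunarySeries_le n).trans (by exact_mod_cast (one_le : 1 ≤ n))
  -- With this choice α - εv = (α - 1)/2 > -1, so σ^{-εv} is integrable with respect to μ_α.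
  set ε := (α + 1) / (2 * v) with hε
  have hε0 : 0 < ε := by
    have : 0 < α + 1 := by linarith
    positivity
  set q := (2 : ℝ) ^ (-ε) with hq
  have hq0 : 0 < q := by positivity
  have hq1 : q < 1 := Real.rpow_lt_one_of_one_lt_of_neg one_lt_two (by linarith)
  have hl : 0 < Real.log 2 := Real.log_pos one_lt_two
  set D := (ε / Real.log 2) ^ ε / (1 - q) with hD
  have hD0 : 0 < D := div_pos (by positivity) (by linarith)
  set I := ∫ σ, σ ^ (-ε * v) ∂muMeasure α with hI
  have hint : Integrable (fun σ : ℝ => σ ^ (-ε * v)) (muMeasure α) := by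
    refine integrable_muMeasure_rpow hα ?_
    rw [hε]
    field_simp
    linarith
  have hI0 : 0 ≤ I := by
    refine integral_nonneg_of_ae ?_
    filter_upwards [ae_pos_muMeasure α] with σ hσ
    exact Real.rpow_nonneg hσ.le _
  have hbound : ∀ k j : ℕ, k ≤ j →
      (lacunaryPolynomial j - lacunaryPolynomial k).mixedIntegral u v α ≤ (D * q ^ k) ^ v * I := by
    intro k j hkj
    rw [hI, ← integral_const_mul]
    refine integral_mono_ae
      (DirichletPolynomial.integrable_hardyNorm_translate_rpow hu hv hα _) (hint.const_mul _) ?_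
    filter_upwards [ae_pos_muMeasure α] with σ hσ
    have h1 : ((lacunaryPolynomial j - lacunaryPolynomial k).translate σ).hardyNorm u ≤
        D * q ^ k * σ ^ (-ε) := by
      refine DirichletPolynomial.hardyNorm_le_of_norm_le hu (by positivity) fun x => ?_
      refine (norm_bohrLift_translate_lacunaryPolynomial_sub_le hkj σ x).trans ?_
      refine (Finset.sum_le_sum fun i _ => two_pow_two_pow_rpow_le hε0 hσ i).trans ?_
      rw [← Finset.mul_sum]
      have h2 : ∑ i ∈ Finset.Ico k j, q ^ i ≤ q ^ k / (1 - q) :=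
        geom_sum_Ico_le_of_lt_one hq0.le hq1
      calc _ ≤ (ε / Real.log 2) ^ ε * σ ^ (-ε) * (q ^ k / (1 - q)) :=
            mul_le_mul_of_nonneg_left h2 (by positivity)
        _ = _ := by rw [hD]; ring
    calc _ ≤ (D * q ^ k * σ ^ (-ε)) ^ v :=
          Real.rpow_le_rpow (DirichletPolynomial.hardyNorm_nonneg _ _) h1 hv.le
      _ = _ := by
          rw [Real.mul_rpow (by positivity) (by positivity), ← Real.rpow_mul hσ.le]
  have hlim : Tendsto (fun k : ℕ => (D * q ^ k) ^ v * I) atTop (𝓝 0) := by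
    have h1 : Tendsto (fun k : ℕ => D * q ^ k) atTop (𝓝 0) := by
      simpa using (tendsto_pow_atTop_nhds_zero_of_lt_one hq0.le hq1).const_mul D
    have h2 := (h1.rpow_const (p := v) (Or.inr hv.le)).mul_const I
    rwa [Real.zero_rpow hv.ne', zero_mul] at h2
  intro δ hδ
  obtain ⟨K, hK⟩ := eventually_atTop.1 (hlim.eventually_lt_const (Real.rpow_pos_of_pos hδ v))
  refine ⟨K, fun j k hj hk => ?_⟩
  rw [DirichletPolynomial.mixedNorm_lt_iff hv hδ.le]
  rcases le_total k j with h | h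
  · exact (hbound k j h).trans_lt (hK k hk)
  · rw [← neg_sub, DirichletPolynomial.mixedIntegral_neg]
    exact (hbound j k h).trans_lt (hK j hj)

/-! ### Rotations and the restriction to powers of 2 -/

namespace DirichletPolynomial

/-- Rotation of the variables by the one-parameter group of the weight `w`. -/
def rotate (w : ℕ → ℕ) (t : UnitAddCircle) (P : DirichletPolynomial) : DirichletPolynomial :=
  P.multiplier fun n => 𝐞 t ^ weightedOmega w n

lemma hardyIntegral_rotate (w : ℕ → ℕ) (t : UnitAddCircle) (P : DirichletPolynomial) (p : ℝ) :
    (P.rotate w t).hardyIntegral p = P.hardyIntegral p := by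
  have h : ∀ x, (P.rotate w t).bohrLift x = P.bohrLift (x + weightFlow w t) := fun x => by
    rw [rotate, ← eval_slice, eval_slice_fourier]
  simp only [hardyIntegral, h]
  exact integral_add_right_eq_self (fun x => ‖P.bohrLift x‖ ^ p) _

lemma rotate_sub (w : ℕ → ℕ) (t : UnitAddCircle) (P Q : DirichletPolynomial) :
    (P - Q).rotate w t = P.rotate w t - Q.rotate w t := multiplier_sub _ _ _

lemma hardyIntegral_sub_le {p : ℝ} (hp : 0 < p) (P Q : DirichletPolynomial) :
    (P - Q).hardyIntegral p ≤ 2 ^ p * (P.hardyIntegral p + Q.hardyIntegral p) := by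
  have h := hardyIntegral_add_le hp P (-Q)
  rwa [← sub_eq_add_neg, hardyIntegral_neg] at h

/-- Rotations are continuous in the Hardy (quasi-)norm. -/
lemma tendsto_hardyIntegral_rotate_sub (w : ℕ → ℕ) (P : DirichletPolynomial) {p : ℝ} (hp : 0 < p) :
    Tendsto (fun t => (P.rotate w t - P).hardyIntegral p) (𝓝 0) (𝓝 0) := by
  have hc : Continuous fun t : UnitAddCircle =>
      (∑ n ∈ P.support, ‖(𝐞 t ^ weightedOmega w n - 1) * P n‖) ^ p := by
    refine Continuous.rpow_const ?_ fun _ => Or.inr hp.le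
    exact continuous_finsetSum _ fun n _ =>
      ((((map_continuous 𝐞).pow _).sub continuous_const).mul continuous_const).norm
  have h0 := hc.tendsto 0
  simp only [fourier_eval_zero, one_pow, sub_self, zero_mul, norm_zero, Finset.sum_const_zero,
    Real.zero_rpow hp.ne'] at h0
  refine squeeze_zero (fun t => hardyIntegral_nonneg _ _) (fun t => ?_) h0
  refine hardyIntegral_le_of_norm_le hp fun x => ?_
  have e : P.rotate w t - P = P.multiplier fun n => 𝐞 t ^ weightedOmega w n - 1 := by
    ext n
    simp [rotate, sub_mul]
  rw [e]
  exact norm_bohrLift_le (support_multiplier_subset _ _) x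

/-- The part of a Dirichlet polynomial which depends on the powers of `2` only. -/
def twoPart (P : DirichletPolynomial) : DirichletPolynomial :=
  P.multiplier fun n => if weightedOmega (fun p => if p = 2 then 0 else 1) n = 0 then 1 else 0

lemma hardyIntegral_twoPart_le (P : DirichletPolynomial) {p : ℝ} (hp : 0 < p) :
    P.twoPart.hardyIntegral p ≤ P.hardyIntegral p := by
  -- The weight vanishes at 2 only, so degree 0 means a power of 2. For degree 0 one may take r = 0
  -- (as 0^0 = 1), which makes the constant 1.
  have h := hardyIntegral_homogeneous_le (fun p => if p = 2 then 0 else 1) P 0 hp le_rfl one_pos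
  simpa [twoPart] using h

lemma weightedOmega_two_pow (w : ℕ → ℕ) (m : ℕ) : weightedOmega w (2 ^ m) = m * w 2 := by
  rw [weightedOmega, PNat.pow_coe, PNat.val_ofNat, Nat.Prime.factorization_pow Nat.prime_two,
    Finsupp.sum_single_index (zero_mul _)]

lemma eq_two_pow_of_weightedOmega_eq_zero {n : ℕ+}
    (h : weightedOmega (fun p => if p = 2 then 0 else 1) n = 0) : ∃ m : ℕ, n = 2 ^ m := by
  refine ⟨(n : ℕ).factorization 2, PNat.eq ?_⟩
  rw [weightedOmega, Finsupp.sum, Finset.sum_eq_zero_iff] at h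
  have hsub : (n : ℕ).factorization.support ⊆ {2} := by
    intro p hp
    have h1 := h p hp
    rw [Finset.mem_singleton]
    by_contra hne
    rw [if_neg hne, mul_one] at h1
    exact (Finsupp.mem_support_iff.1 hp) h1
  conv_lhs => rw [← Nat.prod_factorization_pow_eq_self n.ne_zero]
  rw [Finsupp.prod_of_support_subset _ hsub _ fun p _ => pow_zero p, Finset.prod_singleton]
  simp

@[simp]
lemma twoPart_two_pow (P : DirichletPolynomial) (m : ℕ) : P.twoPart (2 ^ m) = P (2 ^ m) := by
  rw [twoPart, multiplier_apply, weightedOmega_two_pow, if_pos (by simp), one_mul]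

lemma twoPart_eq_zero (P : DirichletPolynomial) {n : ℕ+} (hn : ∀ m : ℕ, n ≠ 2 ^ m) :
    P.twoPart n = 0 := by
  rw [twoPart, multiplier_apply, if_neg, zero_mul]
  intro h
  obtain ⟨m, hm⟩ := eq_two_pow_of_weightedOmega_eq_zero h
  exact hn m hm

lemma hardyIntegral_single {p : ℝ} (n : ℕ+) (c : ℂ) :
    hardyIntegral p (Finsupp.single n c) = ‖c‖ ^ p := by
  simp [hardyIntegral, bohrLift_single, norm_bohrMonomial]

/-- Among powers of 2 the degree in z_2 determines the monomial, so bounds for homogeneous parts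
become bounds for coefficients. -/
lemma multiplier_twoPart_eq_single (P : DirichletPolynomial) (m : ℕ) :
    (P.twoPart.multiplier fun n => if weightedOmega (Pi.single 2 1) n = m then 1 else 0) =
      Finsupp.single (2 ^ m) (P (2 ^ m)) := by
  ext n
  rw [multiplier_apply, Finsupp.single_apply]
  by_cases hn : ∃ k : ℕ, n = 2 ^ k
  · obtain ⟨k, rfl⟩ := hn
    have : ((2 ^ m : ℕ+) = 2 ^ k) ↔ k = m :=
      PNat.two_pow_injective.eq_iff.trans eq_comm
    simp only [twoPart_two_pow, weightedOmega_two_pow, this, Pi.single_eq_same, mul_one]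
    split_ifs with h
    · rw [h, one_mul]
    · rw [zero_mul]
  · push Not at hn
    rw [twoPart_eq_zero P hn, mul_zero, if_neg (hn m).symm]

/-- The growth of the coefficients along the powers of `2`. -/
lemma norm_apply_two_pow_rpow_le (P : DirichletPolynomial) (m : ℕ) {p : ℝ} (hp : 0 < p) {r : ℝ}
    (hr0 : 0 ≤ r) (hr : r < 1) :
    (r ^ m * ‖P (2 ^ m)‖) ^ p ≤ (1 + r) / (1 - r) * P.hardyIntegral p := by
  have h := hardyIntegral_homogeneous_le (Pi.single 2 1) P.twoPart m hp hr0 hr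
  rw [multiplier_twoPart_eq_single, hardyIntegral_single,
    ← Real.mul_rpow (by positivity) (norm_nonneg _)] at h
  exact h.trans (mul_le_mul_of_nonneg_left (hardyIntegral_twoPart_le P hp)
    (div_nonneg (by linarith) (by linarith)))

/-- The coefficients at the powers of `2` are bounded by the Hardy norm with exponent `1`. -/
lemma norm_apply_two_pow_le (P : DirichletPolynomial) (m : ℕ) (hP : P.twoPart = P) :
    ‖P (2 ^ m)‖ ≤ P.hardyIntegral 1 := by
  have h := hardyIntegral_one_homogeneous_le (Pi.single 2 1) P.twoPart m
  rwa [multiplier_twoPart_eq_single, hardyIntegral_single, Real.rpow_one, hP] at h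

lemma norm_bohrLift_le_tsum {P : DirichletPolynomial} (hP : P.twoPart = P)
    (x : PrimeTorus) : ‖P.bohrLift x‖ ≤ ∑' m : ℕ, ‖P (2 ^ m)‖ := by
  have hsum : Summable fun n => ‖P n‖ := summable_of_ne_finset_zero (s := P.support) fun n hn => by
    rw [Finsupp.notMem_support_iff.1 hn, norm_zero]
  have h1 : ∑' m : ℕ, ‖P (2 ^ m)‖ = ∑' n, ‖P n‖ := by
    refine PNat.two_pow_injective.tsum_eq (f := fun n => ‖P n‖) fun n hn => ?_
    by_contra h
    refine hn ?_
    simp only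
    rw [← hP, twoPart_eq_zero, norm_zero]
    exact fun m hm => h ⟨m, hm.symm⟩
  rw [h1, tsum_eq_sum (s := P.support) fun n hn => by
    rw [Finsupp.notMem_support_iff.1 hn, norm_zero]]
  exact norm_bohrLift_le subset_rfl x

lemma twoPart_multiplier (c : ℕ+ → ℂ) (P : DirichletPolynomial) :
    (P.multiplier c).twoPart = P.twoPart.multiplier c := by
  rw [twoPart, twoPart, multiplier_multiplier, multiplier_multiplier]
  simp only [mul_comm]

lemma twoPart_sub (P Q : DirichletPolynomial) : (P - Q).twoPart = P.twoPart - Q.twoPart :=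
  multiplier_sub _ _ _

lemma twoPart_twoPart (P : DirichletPolynomial) : P.twoPart.twoPart = P.twoPart := by
  ext n
  simp only [twoPart, multiplier_apply]
  split_ifs <;> simp

end DirichletPolynomial

/-! ### The lacunary series lies in no Hardy space -/

open DirichletPolynomial

lemma twoPart_lacunaryPolynomial (K : ℕ) :
    (lacunaryPolynomial K).twoPart = lacunaryPolynomial K := by
  ext n
  by_cases hn : ∃ m : ℕ, n = 2 ^ m
  · obtain ⟨m, rfl⟩ := hn
    rw [twoPart_two_pow]
  · push Not at hn
    rw [twoPart_eq_zero _ hn, lacunaryPolynomial_apply]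
    exact (Finset.sum_eq_zero fun k _ => if_neg (hn (2 ^ k)).symm).symm

lemma lacunaryPolynomial_two_pow_two_pow {K k : ℕ} (hk : k < K) :
    lacunaryPolynomial K (2 ^ 2 ^ k) = 1 := by
  rw [lacunaryPolynomial_apply]
  have : ∀ i : ℕ, ((2 ^ 2 ^ i : ℕ+) = 2 ^ 2 ^ k) ↔ i = k := fun i =>
    PNat.two_pow_two_pow_injective.eq_iff
  simp only [this]
  rw [Finset.sum_ite_eq', if_pos (Finset.mem_range.2 hk)]

/-- The root of unity of order `2 ^ K`. -/
def dyadicRoot (K : ℕ) : ℂ := Complex.exp (Complex.I * (2 * Real.pi / 2 ^ K : ℝ))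

lemma fourier_dyadic (K : ℕ) :
    (fourier 1 : C(UnitAddCircle, ℂ)) ((1 / 2 ^ K : ℝ) : UnitAddCircle) = dyadicRoot K := by
  rw [fourier_coe_apply, dyadicRoot]
  congr 1
  push_cast
  ring

lemma norm_dyadicRoot (K : ℕ) : ‖dyadicRoot K‖ = 1 := by
  rw [dyadicRoot, mul_comm]
  exact Complex.norm_exp_ofReal_mul_I _

lemma norm_dyadicRoot_pow_sub_one_le (K m : ℕ) :
    ‖dyadicRoot K ^ m - 1‖ ≤ 2 * Real.pi * m / 2 ^ K := by
  have e : dyadicRoot K ^ m = Complex.exp (Complex.I * (2 * Real.pi * m / 2 ^ K : ℝ)) := by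
    rw [dyadicRoot, ← Complex.exp_nat_mul]
    congr 1
    push_cast
    ring
  rw [e]
  refine (Real.norm_exp_I_mul_ofReal_sub_one_le).trans_eq ?_
  exact Real.norm_of_nonneg (by positivity)

lemma dyadicRoot_pow_eq_one {K k : ℕ} (h : K ≤ k) : dyadicRoot K ^ 2 ^ k = 1 := by
  have e : dyadicRoot K ^ 2 ^ K = 1 := by
    rw [dyadicRoot, ← Complex.exp_nat_mul, ← Complex.exp_two_pi_mul_I]
    congr 1
    push_cast
    field_simp
  obtain ⟨d, rfl⟩ := Nat.exists_eq_add_of_le h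
  rw [pow_add, pow_mul, e, one_pow]

lemma dyadicRoot_succ_pow (K : ℕ) : dyadicRoot (K + 1) ^ 2 ^ K = -1 := by
  rw [dyadicRoot, ← Complex.exp_nat_mul, ← Complex.exp_pi_mul_I]
  congr 1
  push_cast
  field_simp
  ring

/-- The polynomial `∑_{k < K} (ζ^{2^k} - 1) r^{2^k} 2^{-2^k s}` with `ζ = exp (2 π i / 2^K)`. -/
def dyadicDifference (K : ℕ) (r : ℝ) : DirichletPolynomial :=
  (lacunaryPolynomial K).multiplier fun n =>
    (dyadicRoot K ^ weightedOmega (Pi.single 2 1) n - 1) * (r : ℂ) ^ weightedOmega (Pi.single 2 1) n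

/-- Since |ζ^{2^k} - 1| ≤ 2π 2^k / 2^K, the coefficients are dominated by a geometric progression
with sum below 2π < 7, uniformly in K and r. -/
lemma norm_bohrLift_dyadicDifference_le {K : ℕ} {r : ℝ} (hr0 : 0 ≤ r) (hr : r ≤ 1)
    (x : PrimeTorus) : ‖(dyadicDifference K r).bohrLift x‖ ≤ 7 := by
  classical
  have hsupp : (dyadicDifference K r).support ⊆
      (Finset.range K).image fun k => (2 ^ 2 ^ k : ℕ+) := by
    intro n hn
    have h1 := Finsupp.mem_support_iff.1 (support_multiplier_subset _ _ hn)
    rw [lacunaryPolynomial_apply] at h1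
    obtain ⟨k, hk, h2⟩ := Finset.exists_ne_zero_of_sum_ne_zero h1
    exact Finset.mem_image.2 ⟨k, hk, by by_contra h; exact h2 (if_neg h)⟩
  refine (norm_bohrLift_le hsupp x).trans ?_
  rw [Finset.sum_image fun a _ b _ h => PNat.two_pow_two_pow_injective h]
  have h1 : ∀ k ∈ Finset.range K, ‖dyadicDifference K r (2 ^ 2 ^ k)‖ ≤
      2 * Real.pi / 2 ^ K * 2 ^ k := by
    intro k hk
    rw [dyadicDifference, multiplier_apply, weightedOmega_two_pow, Pi.single_eq_same, mul_one,
      lacunaryPolynomial_two_pow_two_pow (Finset.mem_range.1 hk), mul_one, norm_mul, norm_pow,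
      Complex.norm_real, Real.norm_of_nonneg hr0]
    refine (mul_le_of_le_one_right (norm_nonneg _) (pow_le_one₀ hr0 hr)).trans ?_
    refine (norm_dyadicRoot_pow_sub_one_le K (2 ^ k)).trans_eq ?_
    push_cast
    ring
  refine (Finset.sum_le_sum h1).trans ?_
  rw [← Finset.mul_sum, geom_sum_eq (by norm_num)]
  have h2 : (0 : ℝ) < 2 ^ K := by positivity
  calc 2 * Real.pi / 2 ^ K * ((2 ^ K - 1) / (2 - 1)) = 2 * Real.pi - 2 * Real.pi / 2 ^ K := by
        field_simp; ring
    _ ≤ 7 := by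
        have := Real.pi_lt_d2
        have : 0 ≤ 2 * Real.pi / 2 ^ K := by positivity
        linarith

/-- The top coefficient has modulus 2 r^{2^K}, because ζ^{2^K} = -1; it exceeds 1 for r near 1 and
bounds the first mean from below. The uniform bound 7 and |R| ≤ 7^{1-p} |R|^p ≤ 7 |R|^p pass this on
to the p-th mean. -/
lemma exists_le_hardyIntegral_dyadicDifference {p : ℝ} (hp : 0 < p) (hp1 : p ≤ 1) (K : ℕ) :
    ∃ r : ℝ, 0 < r ∧ r < 1 ∧ 1 / 7 ≤ (dyadicDifference (K + 1) r).hardyIntegral p := by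
  have hc : Tendsto (fun r : ℝ => 2 * r ^ 2 ^ K) (𝓝[<] 1) (𝓝 2) := by
    have : Continuous fun r : ℝ => 2 * r ^ 2 ^ K := by fun_prop
    simpa using (this.tendsto 1).mono_left nhdsWithin_le_nhds
  obtain ⟨r, hr1, hr0, hr⟩ := ((hc.eventually_const_lt (by norm_num : (1 : ℝ) < 2)).and
    (Ioo_mem_nhdsLT (zero_lt_one (α := ℝ)))).exists
  refine ⟨r, hr0, hr, ?_⟩
  set R := dyadicDifference (K + 1) r with hR
  have h1 : 1 ≤ R.hardyIntegral 1 := by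
    have h := norm_apply_two_pow_le R (2 ^ K) (by
      rw [hR, dyadicDifference, twoPart_multiplier, twoPart_lacunaryPolynomial])
    refine le_trans ?_ h
    rw [hR, dyadicDifference, multiplier_apply, weightedOmega_two_pow, Pi.single_eq_same, mul_one,
      lacunaryPolynomial_two_pow_two_pow (Nat.lt_succ_self K), dyadicRoot_succ_pow, mul_one,
      norm_mul, norm_pow, Complex.norm_real, Real.norm_of_nonneg hr0.le]
    norm_num
    exact hr1.le
  have h2 : R.hardyIntegral 1 ≤ 7 * R.hardyIntegral p := by
    rw [hardyIntegral, hardyIntegral, ← integral_const_mul]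
    refine integral_mono (integrable_norm_bohrLift_rpow one_pos R)
      ((integrable_norm_bohrLift_rpow hp R).const_mul 7) fun x => ?_
    have h7 := norm_bohrLift_dyadicDifference_le (K := K + 1) hr0.le hr.le x
    rw [← hR] at h7
    have h0 := norm_nonneg (R.bohrLift x)
    simp only
    calc ‖R.bohrLift x‖ ^ (1 : ℝ) = ‖R.bohrLift x‖ ^ (1 - p) * ‖R.bohrLift x‖ ^ p := by
          rcases h0.eq_or_lt with h | h
          · rw [← h, Real.zero_rpow hp.ne', mul_zero, Real.zero_rpow one_ne_zero]
          · rw [← Real.rpow_add h, sub_add_cancel]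
      _ ≤ 7 * ‖R.bohrLift x‖ ^ p := by
          refine mul_le_mul_of_nonneg_right ?_ (by positivity)
          calc ‖R.bohrLift x‖ ^ (1 - p) ≤ 7 ^ (1 - p) :=
                Real.rpow_le_rpow h0 h7 (by linarith)
            _ ≤ 7 ^ (1 : ℝ) := Real.rpow_le_rpow_of_exponent_le (by norm_num) (by linarith)
            _ = 7 := Real.rpow_one 7
  linarith

/-- For polynomials in z_2 alone, dominated convergence of the coefficients gives uniform
convergence of the Bohr lifts. -/
lemma tendsto_hardyIntegral_zero_of_dominated {F : ℕ → DirichletPolynomial} {bound : ℕ → ℝ}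
    (hF : ∀ j, (F j).twoPart = F j) (hb : Summable bound)
    (hle : ∀ᶠ j in atTop, ∀ m : ℕ, ‖F j (2 ^ m)‖ ≤ bound m)
    (hlim : ∀ m : ℕ, Tendsto (fun j => F j (2 ^ m)) atTop (𝓝 0)) {p : ℝ} (hp : 0 < p) :
    Tendsto (fun j => (F j).hardyIntegral p) atTop (𝓝 0) := by
  have h := tendsto_tsum_of_dominated_convergence (f := fun j m => ‖F j (2 ^ m)‖)
    (g := fun _ => 0) hb (fun m => by simpa using (hlim m).norm)
    (by simpa using hle)
  rw [tsum_zero] at h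
  have h2 := h.rpow_const (p := p) (Or.inr hp.le)
  rw [Real.zero_rpow hp.ne'] at h2
  exact squeeze_zero (fun j => hardyIntegral_nonneg _ _)
    (fun j => hardyIntegral_le_of_norm_le hp (norm_bohrLift_le_tsum (hF j))) h2

/-- If `P_j` is bounded in the Hardy (quasi-)norm and tends to the lacunary series coefficientwise,
then the differences between the dilated rotated polynomials and the polynomials themselves tend
to a polynomial. -/
lemma tendsto_hardyIntegral_sub_dyadicDifference {P : ℕ → DirichletPolynomial} {p M : ℝ}
    (hp : 0 < p) (hM : ∀ᶠ j in atTop, (P j).hardyIntegral p ≤ M)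
    (hlim : ∀ n, Tendsto (fun j => P j n) atTop (𝓝 (lacunarySeries n))) (K : ℕ) {r : ℝ}
    (hr0 : 0 < r) (hr : r < 1) :
    Tendsto (fun j => (((P j).twoPart - lacunaryPolynomial K).multiplier fun n =>
      (dyadicRoot K ^ weightedOmega (Pi.single 2 1) n - 1) *
        (r : ℂ) ^ weightedOmega (Pi.single 2 1) n).hardyIntegral p) atTop (𝓝 0) := by
  -- Boundedness in the Hardy quasi-norm gives |P_j(2^m)| ≤ B ρ^{-m}, so the dilated coefficients
  -- are dominated by a geometric series of ratio r/ρ.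
  obtain ⟨ρ, hrρ, hρ⟩ := exists_between hr
  have hρ0 : 0 < ρ := hr0.trans hrρ
  have happ : ∀ (j m : ℕ), (((P j).twoPart - lacunaryPolynomial K).multiplier fun n =>
      (dyadicRoot K ^ weightedOmega (Pi.single 2 1) n - 1) *
        (r : ℂ) ^ weightedOmega (Pi.single 2 1) n) (2 ^ m) =
      (dyadicRoot K ^ m - 1) * (r : ℂ) ^ m * (P j (2 ^ m) - lacunaryPolynomial K (2 ^ m)) := by
    intro j m
    rw [multiplier_apply, weightedOmega_two_pow, Pi.single_eq_same, mul_one, Finsupp.sub_apply,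
      twoPart_two_pow]
  set B := ((1 + ρ) / (1 - ρ) * max M 0) ^ (1 / p) with hB
  have hB1 : 0 ≤ (1 + ρ) / (1 - ρ) * max M 0 :=
    mul_nonneg (div_nonneg (by linarith) (by linarith)) (le_max_right _ _)
  have hB0 : 0 ≤ B := by positivity
  refine tendsto_hardyIntegral_zero_of_dominated (bound := fun m => 2 * (B + 1) * (r / ρ) ^ m) ?_ ?_ ?_ ?_ hp
  · intro j
    rw [twoPart_multiplier, twoPart_sub, twoPart_twoPart, twoPart_lacunaryPolynomial]
  · exact (summable_geometric_of_lt_one (by positivity) ((div_lt_one hρ0).2 hrρ)).mul_left _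
  · filter_upwards [hM] with j hj m
    rw [happ, norm_mul, norm_mul, norm_pow, Complex.norm_real, Real.norm_of_nonneg hr0.le, div_pow]
    have h1 : ‖dyadicRoot K ^ m - 1‖ ≤ 2 := by
      refine (norm_sub_le _ _).trans_eq ?_
      rw [norm_pow, norm_dyadicRoot, one_pow, norm_one]
      norm_num
    have h2 : ρ ^ m * ‖P j (2 ^ m)‖ ≤ B := by
      have h3 := norm_apply_two_pow_rpow_le (P j) m hp hρ0.le hρ
      rw [hB, one_div, Real.le_rpow_inv_iff_of_pos (by positivity) hB1 hp]
      refine h3.trans (mul_le_mul_of_nonneg_left (hj.trans (le_max_left _ _))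
        (div_nonneg (by linarith) (by linarith)))
    have h4 : ‖lacunaryPolynomial K (2 ^ m)‖ ≤ 1 := by
      rw [lacunaryPolynomial_apply]
      by_cases h : ∃ k : ℕ, (2 ^ m : ℕ+) = 2 ^ 2 ^ k
      · obtain ⟨k, hk⟩ := h
        have : ∀ i : ℕ, ((2 ^ 2 ^ i : ℕ+) = 2 ^ 2 ^ k) ↔ i = k := fun i =>
          PNat.two_pow_two_pow_injective.eq_iff
        simp only [hk, this]
        rw [Finset.sum_ite_eq']
        split_ifs <;> simp
      · push Not at h
        rw [Finset.sum_eq_zero fun k _ => if_neg (h k).symm, norm_zero]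
        exact zero_le_one
    have hρm : 0 < ρ ^ m := by positivity
    have hρ1 : ρ ^ m ≤ 1 := pow_le_one₀ hρ0.le hρ.le
    have h5 : ‖P j (2 ^ m) - lacunaryPolynomial K (2 ^ m)‖ ≤ (B + 1) / ρ ^ m := by
      rw [le_div_iff₀ hρm]
      calc _ ≤ (‖P j (2 ^ m)‖ + 1) * ρ ^ m := mul_le_mul_of_nonneg_right
            ((norm_sub_le _ _).trans (by gcongr)) hρm.le
        _ ≤ B + 1 := by nlinarith
    calc _ ≤ 2 * r ^ m * ((B + 1) / ρ ^ m) := by gcongr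
      _ = _ := by ring
  · intro m
    simp only [happ]
    have h1 := ((hlim (2 ^ m)).sub_const (lacunaryPolynomial K (2 ^ m))).const_mul
      ((dyadicRoot K ^ m - 1) * (r : ℂ) ^ m)
    convert h1 using 2
    -- The limit coefficient vanishes in each case: for k < K the partial sum has the same
    -- coefficient, for k ≥ K the rotation is trivial, and elsewhere both coefficients are 0.
    by_cases h : ∃ k : ℕ, m = 2 ^ k
    · obtain ⟨k, rfl⟩ := h
      rcases lt_or_ge k K with hk | hk
      · rw [lacunaryPolynomial_two_pow_two_pow hk, lacunarySeries_two_pow_two_pow, sub_self,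
          mul_zero]
      · rw [dyadicRoot_pow_eq_one hk, sub_self, zero_mul, zero_mul]
    · push Not at h
      have h' : ∀ k : ℕ, (2 ^ m : ℕ+) ≠ 2 ^ 2 ^ k := fun k hk => h k (PNat.two_pow_injective hk)
      rw [lacunarySeries_eq_zero h', lacunaryPolynomial_apply,
        Finset.sum_eq_zero fun k _ => if_neg (h' k).symm, sub_self, mul_zero]

/-- A Cauchy sequence is equicontinuous under rotations, because each P_j is close to one fixed P_J.
Small dyadic rotations should thus move the limit by little, but the polynomial they produce has
p-th mean at least 1/7. -/
lemma lacunarySeries_notMem_hardySpace_of_le_one {p : ℝ} (hp : 0 < p) (hp1 : p ≤ 1) :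
    lacunarySeries ∉ hardySpace p := by
  rintro ⟨-, P, hP, hlim⟩
  have h2p : (2 : ℝ) ^ p ≤ 2 := by
    simpa using Real.rpow_le_rpow_of_exponent_le one_le_two hp1
  have h2p0 : (0 : ℝ) < 2 ^ p := by positivity
  -- With 2^p ≤ 2, the errors add up to at most 2 (2 (4/200 + 1/200) + 1/200) = 11/100 < 1/7.
  obtain ⟨J, hJ⟩ := hP ((1 / 200) ^ (1 / p)) (by positivity)
  have hJ' : ∀ j, J ≤ j → (P j - P J).hardyIntegral p < 1 / 200 := by
    intro j hj
    have h := (hardyNorm_lt_iff hp (by positivity)).1 (hJ j J hj le_rfl)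
    rwa [← Real.rpow_mul (by norm_num), one_div_mul_cancel hp.ne', Real.rpow_one] at h
  have hM : ∀ᶠ j in atTop, (P j).hardyIntegral p ≤
      2 ^ p * (1 / 200 + (P J).hardyIntegral p) := by
    filter_upwards [eventually_ge_atTop J] with j hj
    have h := hardyIntegral_add_le hp (P j - P J) (P J)
    rw [sub_add_cancel] at h
    exact h.trans (mul_le_mul_of_nonneg_left (by linarith [hJ' j hj]) h2p0.le)
  have hdy : Tendsto (fun K : ℕ => ((1 / 2 ^ (K + 1) : ℝ) : UnitAddCircle)) atTop (𝓝 0) := by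
    have h1 : Tendsto (fun K : ℕ => (1 / 2 ^ (K + 1) : ℝ)) atTop (𝓝 0) := by
      have := tendsto_pow_atTop_nhds_zero_of_lt_one (r := (1 / 2 : ℝ)) (by norm_num) (by norm_num)
      simpa using (tendsto_add_atTop_iff_nat 1).2 this
    exact ((AddCircle.continuous_mk' 1).tendsto 0).comp h1
  obtain ⟨K, hK⟩ := (((tendsto_hardyIntegral_rotate_sub (Pi.single 2 1) (P J) hp).comp
    hdy).eventually_lt_const (by norm_num : (0 : ℝ) < 1 / 200)).exists
  simp only [Function.comp_apply] at hK
  set t : UnitAddCircle := ((1 / 2 ^ (K + 1) : ℝ) : UnitAddCircle) with ht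
  obtain ⟨r, hr0, hr, hlow⟩ := exists_le_hardyIntegral_dyadicDifference hp hp1 K
  have hE := tendsto_hardyIntegral_sub_dyadicDifference hp hM hlim (K + 1) hr0 hr
  obtain ⟨j, hEj, hj⟩ := ((hE.eventually_lt_const (by norm_num : (0 : ℝ) < 1 / 200)).and
    (eventually_ge_atTop J)).exists
  set d : ℕ+ → ℂ := fun n => (dyadicRoot (K + 1) ^ weightedOmega (Pi.single 2 1) n - 1) *
        (r : ℂ) ^ weightedOmega (Pi.single 2 1) n with hd
  have hrot : ((P j).rotate (Pi.single 2 1) t - P j).hardyIntegral p ≤ 2 * (4 * (1 / 200) +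
      1 / 200) := by
    have e : (P j).rotate (Pi.single 2 1) t - P j =
        ((P j - P J).rotate (Pi.single 2 1) t - (P j - P J)) +
          ((P J).rotate (Pi.single 2 1) t - P J) := by
      rw [rotate_sub]; abel
    have h1 := hardyIntegral_sub_le hp ((P j - P J).rotate (Pi.single 2 1) t) (P j - P J)
    rw [hardyIntegral_rotate] at h1
    have h2 := hardyIntegral_add_le hp ((P j - P J).rotate (Pi.single 2 1) t - (P j - P J))
      ((P J).rotate (Pi.single 2 1) t - P J)
    rw [← e] at h2
    have h3 := hJ' j hj
    have h4 := hardyIntegral_nonneg p (P j - P J)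
    have h5 := hardyIntegral_nonneg p ((P j - P J).rotate (Pi.single 2 1) t - (P j - P J))
    have h6 := hardyIntegral_nonneg p ((P J).rotate (Pi.single 2 1) t - P J)
    nlinarith
  -- The multiplier d is the rotation difference followed by dilation by r; dilation and restriction
  -- to powers of 2 are both contractions.
  have hmain : ((P j).twoPart.multiplier d).hardyIntegral p ≤ 2 * (4 * (1 / 200) + 1 / 200) := by
    have e : (P j).twoPart.multiplier d =
        (((P j).rotate (Pi.single 2 1) t - P j).twoPart).multiplier fun n =>
          (r : ℂ) ^ weightedOmega (Pi.single 2 1) n := by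
      rw [← twoPart_multiplier, ← twoPart_multiplier]
      congr 1
      ext n
      simp only [multiplier_apply, rotate, Finsupp.sub_apply, hd, ht]
      rw [fourier_dyadic]
      ring
    rw [e]
    exact (hardyIntegral_multiplier_pow_le _ _ hp hr0.le hr.le).trans
      ((hardyIntegral_twoPart_le _ hp).trans hrot)
  have hfin : (dyadicDifference (K + 1) r).hardyIntegral p ≤
      2 ^ p * (2 * (4 * (1 / 200) + 1 / 200) + 1 / 200) := by
    have e : dyadicDifference (K + 1) r = (P j).twoPart.multiplier d -
        ((P j).twoPart - lacunaryPolynomial (K + 1)).multiplier d := by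
      rw [multiplier_sub, dyadicDifference]
      abel
    rw [e]
    exact (hardyIntegral_sub_le hp _ _).trans
      (mul_le_mul_of_nonneg_left (add_le_add hmain hEj.le) h2p0.le)
  nlinarith

/-- Hardy spaces decrease in the exponent, so `min p 1` suffices. -/
theorem lacunarySeries_notMem_hardySpace {p : ℝ} (hp : 0 < p) : lacunarySeries ∉ hardySpace p :=
  fun h => lacunarySeries_notMem_hardySpace_of_le_one (lt_min hp one_pos) (min_le_right p 1)
    (hardySpace_subset_hardySpace (lt_min hp one_pos) (min_le_left p 1) h)

/-! ### Means of |1 + z| on the circle -/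

section CircleMean

/-- The integral `∫ |1 + z|^p` over the unit circle. -/
def circleMean (p : ℝ) : ℝ := ∫ t, ‖1 + 𝐞 t‖ ^ p ∂ℏ

lemma continuous_norm_one_add_fourier : Continuous fun t : UnitAddCircle => ‖1 + 𝐞 t‖ :=
  (continuous_const.add (map_continuous 𝐞)).norm

lemma continuous_norm_one_add_fourier_rpow {p : ℝ} (hp : 0 < p) :
    Continuous fun t : UnitAddCircle => ‖1 + 𝐞 t‖ ^ p :=
  continuous_norm_one_add_fourier.rpow_const fun _ => Or.inr hp.le

/-- This is subharmonicity of |1 + z|^p at the centre of the disc. -/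
lemma one_le_circleMean {p : ℝ} (hp : 0 < p) : 1 ≤ circleMean p := by
  have h := (1 + Polynomial.X : Polynomial ℂ).norm_eval_rpow_le hp (w := 0) (by simp)
  simpa [circleMean] using h

lemma circleMean_rpow_lt {p u : ℝ} (hp : 0 < p) (hpu : p < u) :
    circleMean p ^ (1 / p) < circleMean u ^ (1 / u) := by
  have hu := hp.trans hpu
  have e : ∀ t : UnitAddCircle, (‖1 + 𝐞 t‖ ^ p) ^ (u / p) = ‖1 + 𝐞 t‖ ^ u := fun t => by
    rw [← Real.rpow_mul (norm_nonneg _), mul_div_cancel₀ _ hp.ne']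
  have h := (strictConvexOn_rpow (p := u / p) ((one_lt_div hp).2 hpu)).ae_eq_const_or_map_average_lt
    (μ := ℏ) (f := fun t => ‖1 + 𝐞 t‖ ^ p)
    (Real.continuous_rpow_const (by positivity)).continuousOn isClosed_Ici
    (ae_of_all _ fun t => Real.rpow_nonneg (norm_nonneg _) p)
    (continuous_norm_one_add_fourier_rpow hp).integrable_haarAddCircle (by
      simp only [Function.comp_def, e]
      exact (continuous_norm_one_add_fourier_rpow hu).integrable_haarAddCircle)
  simp only [e, average_eq_integral] at h
  rcases h with h | h
  · exfalso
    -- Equality in Jensen would make the continuous function |1 + z|^p constant, but |1 + z| is 2 at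
    -- z = 1 and 0 at z = -1.
    have h1 := (Continuous.ae_eq_iff_eq ℏ (continuous_norm_one_add_fourier_rpow hp)
      (continuous_const (y := ∫ t, ‖1 + 𝐞 t‖ ^ p ∂ℏ))).1 h
    have h2 := congrFun h1 0
    have h3 := congrFun h1 (((1 / 2 : ℝ)) : UnitAddCircle)
    have e1 : 𝐞 ((1 / 2 : ℝ) : UnitAddCircle) = -1 := by
      rw [fourier_coe_apply, ← Complex.exp_pi_mul_I]
      congr 1
      push_cast
      ring
    rw [fourier_eval_zero] at h2
    rw [e1, ← h2, add_neg_cancel, norm_zero, Real.zero_rpow hp.ne'] at h3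
    norm_num at h3
    exact (Real.rpow_pos_of_pos two_pos p).ne h3
  · have h0 : 0 ≤ circleMean p := zero_le_one.trans (one_le_circleMean hp)
    calc circleMean p ^ (1 / p) = (circleMean p ^ (u / p)) ^ (1 / u) := by
          rw [← Real.rpow_mul h0]; congr 1; field_simp
      _ < _ := Real.rpow_lt_rpow (by positivity) h (by positivity)

end CircleMean

/-! ### One prime per dyadic interval; a weight with finite homogeneous parts -/

section Primes

/-- A prime number in the interval `(2 ^ j, 2 ^ (j + 1)]`. -/
def dyadicPrime (j : ℕ) : ℕ :=
  (Nat.exists_prime_lt_and_le_two_mul (2 ^ j) (by positivity)).choose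

lemma dyadicPrime_prime (j : ℕ) : (dyadicPrime j).Prime :=
  (Nat.exists_prime_lt_and_le_two_mul (2 ^ j) (by positivity)).choose_spec.1

lemma two_pow_lt_dyadicPrime (j : ℕ) : 2 ^ j < dyadicPrime j :=
  (Nat.exists_prime_lt_and_le_two_mul (2 ^ j) (by positivity)).choose_spec.2.1

lemma dyadicPrime_le (j : ℕ) : dyadicPrime j ≤ 2 ^ (j + 1) := by
  rw [pow_succ']
  exact (Nat.exists_prime_lt_and_le_two_mul (2 ^ j) (by positivity)).choose_spec.2.2

lemma dyadicPrime_strictMono : StrictMono dyadicPrime :=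
  strictMono_nat_of_lt_succ fun j => (dyadicPrime_le j).trans_lt (two_pow_lt_dyadicPrime (j + 1))

/-- The prime number `dyadicPrime j` as a positive integer. -/
def dyadicPNat (j : ℕ) : ℕ+ := ⟨dyadicPrime j, (dyadicPrime_prime j).pos⟩

lemma dyadicPNat_coe (j : ℕ) : (dyadicPNat j : ℕ) = dyadicPrime j := rfl

lemma weightedOmega_prod {ι : Type*} (w : ℕ → ℕ) (s : Finset ι) (f : ι → ℕ+) :
    weightedOmega w (∏ i ∈ s, f i) = ∑ i ∈ s, weightedOmega w (f i) := by
  induction s using Finset.cons_induction with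
  | empty => simp [weightedOmega_one]
  | cons i s hi ih => rw [Finset.prod_cons, Finset.sum_cons, weightedOmega_mul, ih]

lemma bohrMonomial_prod {ι : Type*} (s : Finset ι) (f : ι → ℕ+) (x : PrimeTorus) :
    bohrMonomial (∏ i ∈ s, f i) x = ∏ i ∈ s, bohrMonomial (f i) x := by
  induction s using Finset.cons_induction with
  | empty => simp [bohrMonomial_one]
  | cons i s hi ih => rw [Finset.prod_cons, Finset.prod_cons, bohrMonomial_mul, ih]

lemma two_pow_weightedOmega_le (n : ℕ+) : 2 ^ weightedOmega (fun _ => 1) n ≤ (n : ℕ) := by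
  conv_rhs => rw [← Nat.prod_factorization_pow_eq_self n.ne_zero]
  rw [weightedOmega, Finsupp.sum, ← Finset.prod_pow_eq_pow_sum, Finsupp.prod]
  refine Finset.prod_le_prod' fun p hp => ?_
  rw [mul_one]
  rw [Nat.support_factorization] at hp
  exact Nat.pow_le_pow_left (Nat.prime_of_mem_primeFactors hp).two_le _

/-- A weight which singles out the products of `k` prime numbers below `2 ^ (2 * k)`. -/
def blockWeight (k p : ℕ) : ℕ := if p ≤ 2 ^ (2 * k) then 1 else k + 1

/-- A single larger prime would already contribute k + 1 to the degree. -/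
lemma le_of_weightedOmega_blockWeight {k : ℕ} {n : ℕ+}
    (h : weightedOmega (blockWeight k) n = k) {p : ℕ} (hp : p ∈ (n : ℕ).primeFactors) :
    p ≤ 2 ^ (2 * k) := by
  by_contra hlt
  rw [← Nat.support_factorization] at hp
  have h1 : (n : ℕ).factorization p * blockWeight k p ≤ k := by
    conv_rhs => rw [← h, weightedOmega, Finsupp.sum]
    exact Finset.single_le_sum (f := fun p => (n : ℕ).factorization p * blockWeight k p)
      (fun _ _ => Nat.zero_le _) hp
  rw [blockWeight, if_neg hlt] at h1
  have h2 : 1 ≤ (n : ℕ).factorization p := Nat.one_le_iff_ne_zero.2 (Finsupp.mem_support_iff.1 hp)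
  nlinarith

lemma weightedOmega_one_of_blockWeight {k : ℕ} {n : ℕ+}
    (h : weightedOmega (blockWeight k) n = k) : weightedOmega (fun _ => 1) n = k := by
  conv_rhs => rw [← h]
  rw [weightedOmega, weightedOmega, Finsupp.sum, Finsupp.sum]
  refine Finset.sum_congr rfl fun p hp => ?_
  rw [Nat.support_factorization] at hp
  rw [blockWeight, if_pos (le_of_weightedOmega_blockWeight h hp)]

/-- Degree k in this weight leaves only finitely many n, unlike for the plain count of prime
factors. Coefficientwise convergence of such homogeneous parts is therefore convergence in norm. -/
lemma le_two_pow_of_blockWeight {k : ℕ} {n : ℕ+}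
    (h : weightedOmega (blockWeight k) n = k) : (n : ℕ) ≤ (2 ^ (2 * k)) ^ k := by
  refine le_of_le_of_eq ?_ (congrArg ((2 ^ (2 * k)) ^ ·) (weightedOmega_one_of_blockWeight h))
  conv_lhs => rw [← Nat.prod_factorization_pow_eq_self n.ne_zero]
  rw [weightedOmega, Finsupp.sum, ← Finset.prod_pow_eq_pow_sum, Finsupp.prod]
  refine Finset.prod_le_prod' fun p hp => ?_
  rw [Nat.support_factorization] at hp
  rw [mul_one]
  exact Nat.pow_le_pow_left (le_of_weightedOmega_blockWeight h hp) _

end Primes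

/-! ### The products of the sums z_{2i} + z_{2i+1} -/

namespace DirichletPolynomial

lemma bohrLift_sum {ι : Type*} (s : Finset ι) (P : ι → DirichletPolynomial) (x : PrimeTorus) :
    bohrLift (∑ i ∈ s, P i) x = ∑ i ∈ s, (P i).bohrLift x := by
  induction s using Finset.cons_induction with
  | empty => simp [bohrLift]
  | cons i s hi ih => rw [Finset.sum_cons, Finset.sum_cons, bohrLift_add, ih]

/-- The positive integer which is the product of the first members of the pairs in `t` and the
second members of the pairs in `s`. -/
def pairProduct (t s : Finset ℕ) : ℕ+ :=
  (∏ i ∈ t, dyadicPNat (2 * i)) * ∏ i ∈ s, dyadicPNat (2 * i + 1)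

/-- The Dirichlet polynomial with Bohr lift `∏_{i < k} (z_{2i} + z_{2i+1})`, where `z_j` is the
variable which belongs to `dyadicPrime j`. -/
def pairPolynomial (k : ℕ) : DirichletPolynomial :=
  ∑ t ∈ (Finset.range k).powerset, Finsupp.single (pairProduct t (Finset.range k \ t)) 1

lemma bohrMonomial_dyadicPNat (j : ℕ) (x : PrimeTorus) :
    bohrMonomial (dyadicPNat j) x = 𝐞 (coord x (dyadicPrime j)) :=
  bohrMonomial_prime (p := dyadicPNat j) (dyadicPrime_prime j) x

lemma bohrLift_pairPolynomial (k : ℕ) (x : PrimeTorus) :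
    (pairPolynomial k).bohrLift x = ∏ i ∈ Finset.range k,
      (𝐞 (coord x (dyadicPrime (2 * i))) + 𝐞 (coord x (dyadicPrime (2 * i + 1)))) := by
  rw [pairPolynomial, bohrLift_sum, Finset.prod_add]
  refine Finset.sum_congr rfl fun t _ => ?_
  rw [bohrLift_single, one_mul, pairProduct, bohrMonomial_mul, bohrMonomial_prod,
    bohrMonomial_prod]
  simp only [bohrMonomial_dyadicPNat]

lemma norm_fourier_add_fourier_add (a b t : UnitAddCircle) :
    ‖𝐞 a + 𝐞 (b + t)‖ = ‖1 + 𝐞 (b - a + t)‖ := by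
  have e : 𝐞 a + 𝐞 (b + t) = 𝐞 a * (1 + 𝐞 (b - a + t)) := by
    rw [mul_add, mul_one, ← fourier_add_apply]
    congr 2
    abel
  rw [e, norm_mul, norm_fourier_apply, one_mul]

/-- The factors involve disjoint variables, and the modulus of each is distributed as |1 + z|.
Averaging over rotations of the variable z_{2k+1} alone splits off the last factor and leaves the
others fixed. -/
lemma hardyIntegral_pairPolynomial {u : ℝ} (hu : 0 < u) (k : ℕ) :
    (pairPolynomial k).hardyIntegral u = circleMean u ^ k := by
  induction k with
  | zero => simp [hardyIntegral, bohrLift_pairPolynomial]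
  | succ k ih =>
    rw [hardyIntegral, ← integral_integral_add (continuous_norm_bohrLift_rpow hu _)
      (continuous_weightFlow (Pi.single (dyadicPrime (2 * k + 1)) 1)), pow_succ, ← ih,
      hardyIntegral, ← integral_mul_const]
    refine integral_congr_ae (ae_of_all _ fun x => ?_)
    have hco : ∀ (t : UnitAddCircle) (j : ℕ), j ≠ 2 * k + 1 →
        coord (x + weightFlow (Pi.single (dyadicPrime (2 * k + 1)) 1) t) (dyadicPrime j) =
          coord x (dyadicPrime j) := by
      intro t j hj
      rw [coord_add, coord_weightFlow _ (dyadicPrime_prime j), Pi.single_eq_of_ne, zero_smul,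
        add_zero]
      exact fun h => hj (dyadicPrime_strictMono.injective h)
    have hco' : ∀ t : UnitAddCircle,
        coord (x + weightFlow (Pi.single (dyadicPrime (2 * k + 1)) 1) t)
          (dyadicPrime (2 * k + 1)) = coord x (dyadicPrime (2 * k + 1)) + t := by
      intro t
      rw [coord_add, coord_weightFlow _ (dyadicPrime_prime _), Pi.single_eq_same, one_smul]
    have hf : ∀ t : UnitAddCircle, ‖(pairPolynomial (k + 1)).bohrLift
        (x + weightFlow (Pi.single (dyadicPrime (2 * k + 1)) 1) t)‖ ^ u =
        ‖(pairPolynomial k).bohrLift x‖ ^ u *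
          ‖1 + 𝐞 (coord x (dyadicPrime (2 * k + 1)) - coord x (dyadicPrime (2 * k)) + t)‖ ^ u := by
      intro t
      rw [← Real.mul_rpow (norm_nonneg _) (norm_nonneg _), ← norm_fourier_add_fourier_add,
        ← norm_mul, bohrLift_pairPolynomial, bohrLift_pairPolynomial, Finset.prod_range_succ,
        hco', hco t (2 * k) (by omega)]
      congr 3
      refine Finset.prod_congr rfl fun i hi => ?_
      rw [Finset.mem_range] at hi
      rw [hco t _ (by omega), hco t _ (by omega)]
    simp only [hf]
    rw [integral_const_mul, circleMean]
    congr 1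
    exact integral_add_left_eq_self (fun t => ‖1 + 𝐞 t‖ ^ u) _

lemma weightedOmega_eq_of_mem_support {w : ℕ → ℕ} {k : ℕ}
    (hw : ∀ j < 2 * k, w (dyadicPrime j) = 1) {n : ℕ+} (hn : pairPolynomial k n ≠ 0) :
    weightedOmega w n = k := by
  rw [pairPolynomial, Finsupp.finsetSum_apply] at hn
  obtain ⟨t, ht, h⟩ := Finset.exists_ne_zero_of_sum_ne_zero hn
  have hn' : pairProduct t (Finset.range k \ t) = n := by
    by_contra hne
    exact h (Finsupp.single_eq_of_ne (Ne.symm hne))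
  rw [Finset.mem_powerset] at ht
  have hd : ∀ j < 2 * k, weightedOmega w (dyadicPNat j) = 1 := fun j hj => by
    rw [weightedOmega_prime w (p := dyadicPNat j) (dyadicPrime_prime j), dyadicPNat_coe, hw j hj]
  rw [← hn', pairProduct, weightedOmega_mul, weightedOmega_prod, weightedOmega_prod,
    Finset.sum_congr rfl fun i hi => hd (2 * i) (by have := Finset.mem_range.1 (ht hi); omega),
    Finset.sum_congr rfl fun i hi => hd (2 * i + 1) (by
      have := Finset.mem_range.1 (Finset.mem_sdiff.1 hi).1; omega)]
  rw [Finset.sum_const, Finset.sum_const, smul_eq_mul, smul_eq_mul, mul_one, mul_one,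
    add_comm, Finset.card_sdiff_add_card_eq_card ht, Finset.card_range]

lemma weightedOmega_blockWeight_of_ne_zero {k : ℕ} {n : ℕ+} (hn : pairPolynomial k n ≠ 0) :
    weightedOmega (blockWeight k) n = k :=
  weightedOmega_eq_of_mem_support (fun j hj => if_pos ((dyadicPrime_le j).trans
    (Nat.pow_le_pow_right two_pos hj))) hn

lemma weightedOmega_one_of_ne_zero {k : ℕ} {n : ℕ+} (hn : pairPolynomial k n ≠ 0) :
    weightedOmega (fun _ => 1) n = k :=
  weightedOmega_eq_of_mem_support (fun _ _ => rfl) hn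

lemma norm_pairPolynomial_apply_le (k : ℕ) (n : ℕ+) : ‖pairPolynomial k n‖ ≤ 2 ^ k := by
  rw [pairPolynomial, Finsupp.finsetSum_apply]
  refine (norm_sum_le _ _).trans ?_
  refine (Finset.sum_le_card_nsmul _ _ 1 fun t _ => ?_).trans_eq ?_
  · rw [Finsupp.single_apply]
    split_ifs <;> simp
  · rw [Finset.card_powerset, Finset.card_range]
    simp

/-- A small horizontal translation does not decrease the norm of `pairPolynomial k` by much. -/
lemma hardyNorm_translate_pairPolynomial_ge {u : ℝ} (hu : 0 < u) {k : ℕ} {σ : ℝ} (hσ : 0 ≤ σ)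
    (hσk : 2 * (k : ℝ) ^ 2 * σ ≤ 1) :
    1 / 2 * (pairPolynomial k).hardyNorm u ≤ ((pairPolynomial k).translate σ).hardyNorm u := by
  set T := (Finset.range (2 ^ (2 * k) + 1)).filter Nat.Prime with hT
  set ρ : ℝ := 2 ^ (-(2 * k * σ)) with hρ
  have hρ0 : 0 < ρ := by positivity
  have h := hardyIntegral_multiplier_prod_le T (s := fun p => (p : ℝ) ^ σ * ρ)
    (fun p _ => by positivity) (fun p hp => ?_) ((pairPolynomial k).translate σ) hu
  · have e : ((pairPolynomial k).translate σ).multiplier (fun n => ∏ p ∈ T,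
        (((p : ℝ) ^ σ * ρ : ℝ) : ℂ) ^ (n : ℕ).factorization p) =
        ((ρ ^ k : ℝ) : ℂ) • pairPolynomial k := by
      ext n
      rw [translate_eq_multiplier, multiplier_multiplier, multiplier_apply, Finsupp.smul_apply,
        smul_eq_mul]
      by_cases hn : pairPolynomial k n = 0
      · rw [hn, mul_zero, mul_zero]
      congr 1
      have hb := weightedOmega_blockWeight_of_ne_zero hn
      have hsub : (n : ℕ).primeFactors ⊆ T := fun p hp => by
        rw [hT, Finset.mem_filter, Finset.mem_range]
        exact ⟨Nat.lt_succ_of_le (le_of_weightedOmega_blockWeight hb hp),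
          Nat.prime_of_mem_primeFactors hp⟩
      have hO := weightedOmega_one_of_ne_zero hn
      have hsum : ∑ p ∈ T, (n : ℕ).factorization p = k := by
        rw [weightedOmega, Finsupp.sum] at hO
        simp only [mul_one] at hO
        rw [← hO, Nat.support_factorization]
        refine (Finset.sum_subset hsub fun p _ hp => ?_).symm
        rwa [← Nat.support_factorization, Finsupp.notMem_support_iff] at hp
      have h1 : ∏ p ∈ T, ((p : ℝ) ^ σ * ρ) ^ (n : ℕ).factorization p =
          ((n : ℕ) : ℝ) ^ σ * ρ ^ k := by
        simp only [mul_pow]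
        rw [Finset.prod_mul_distrib, Finset.prod_pow_eq_pow_sum, hsum,
          ← natCast_rpow_eq_prod σ n.ne_zero hsub]
      have hn0 : (0 : ℝ) < ((n : ℕ) : ℝ) := by exact_mod_cast n.pos
      have h2 : ((n : ℕ) : ℝ) ^ σ * ρ ^ k * ((n : ℕ) : ℝ) ^ (-σ) = ρ ^ k := by
        rw [mul_right_comm, ← Real.rpow_add hn0, add_neg_cancel, Real.rpow_zero, one_mul]
      rw [← h2, ← h1]
      push_cast
      rfl
    rw [e] at h
    have h3 : (((ρ ^ k : ℝ) : ℂ) • pairPolynomial k).hardyNorm u ≤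
        ((pairPolynomial k).translate σ).hardyNorm u :=
      Real.rpow_le_rpow (hardyIntegral_nonneg _ _) h (by positivity)
    rw [hardyNorm_smul hu, Complex.norm_real, Real.norm_of_nonneg (by positivity)] at h3
    refine le_trans (mul_le_mul_of_nonneg_right ?_ (hardyNorm_nonneg _ _)) h3
    rw [hρ, ← Real.rpow_natCast, ← Real.rpow_mul zero_le_two, one_div, ← Real.rpow_neg_one]
    refine Real.rpow_le_rpow_of_exponent_le one_le_two ?_
    nlinarith
  · rw [hT, Finset.mem_filter, Finset.mem_range, Nat.lt_succ_iff] at hp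
    have h1 : (p : ℝ) ^ σ ≤ 2 ^ (2 * k * σ) := by
      rw [Real.rpow_mul zero_le_two]
      refine Real.rpow_le_rpow (by positivity) ?_ hσ
      exact_mod_cast hp.1
    calc (p : ℝ) ^ σ * ρ ≤ 2 ^ (2 * k * σ) * ρ := mul_le_mul_of_nonneg_right h1 hρ0.le
      _ = 1 := by rw [hρ, ← Real.rpow_add two_pos, add_neg_cancel, Real.rpow_zero]

end DirichletPolynomial

/-! ### Power sums, the mass of μ_α near 0 and homogeneous parts in the mixed norm -/

/-- The power of a sum is bounded by a geometrically weighted sum of powers. -/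
lemma Real.sum_rpow_le_geometric {θ p : ℝ} (hθ0 : 0 < θ) (hθ : θ < 1) (hp : 0 < p) {a : ℕ → ℝ}
    (ha : ∀ i, 0 ≤ a i) (s : Finset ℕ) :
    (∑ i ∈ s, a i) ^ p ≤ (1 - θ)⁻¹ ^ p * ∑ i ∈ s, ((θ ^ i)⁻¹ * a i) ^ p := by
  rcases s.eq_empty_or_nonempty with rfl | hs
  · simp [Real.zero_rpow hp.ne']
  -- Dominating all terms by the largest weighted one works for every p > 0, with no distinction
  -- between p < 1 and p ≥ 1.
  obtain ⟨i₀, hi₀, hmax⟩ := s.exists_max_image (fun i => (θ ^ i)⁻¹ * a i) hs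
  have hb : ∀ i, 0 ≤ (θ ^ i)⁻¹ * a i := fun i => mul_nonneg (by positivity) (ha i)
  have h1 : 0 < (1 - θ)⁻¹ := inv_pos.2 (by linarith)
  have h2 : ∑ i ∈ s, a i ≤ (1 - θ)⁻¹ * ((θ ^ i₀)⁻¹ * a i₀) := by
    calc ∑ i ∈ s, a i ≤ ∑ i ∈ s, θ ^ i * ((θ ^ i₀)⁻¹ * a i₀) := by
          refine Finset.sum_le_sum fun i hi => ?_
          calc a i = θ ^ i * ((θ ^ i)⁻¹ * a i) := by field_simp
            _ ≤ _ := mul_le_mul_of_nonneg_left (hmax i hi) (by positivity)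
      _ = (∑ i ∈ s, θ ^ i) * ((θ ^ i₀)⁻¹ * a i₀) := by rw [Finset.sum_mul]
      _ ≤ _ := by
          refine mul_le_mul_of_nonneg_right ?_ (hb i₀)
          rw [← tsum_geometric_of_lt_one hθ0.le hθ]
          exact (summable_geometric_of_lt_one hθ0.le hθ).sum_le_tsum s fun i _ => by positivity
  calc (∑ i ∈ s, a i) ^ p ≤ ((1 - θ)⁻¹ * ((θ ^ i₀)⁻¹ * a i₀)) ^ p :=
        Real.rpow_le_rpow (Finset.sum_nonneg fun i _ => ha i) h2 hp.le
    _ = (1 - θ)⁻¹ ^ p * ((θ ^ i₀)⁻¹ * a i₀) ^ p := Real.mul_rpow h1.le (hb i₀)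
    _ ≤ _ := by
        refine mul_le_mul_of_nonneg_left ?_ (by positivity)
        exact Finset.single_le_sum (f := fun i => ((θ ^ i)⁻¹ * a i) ^ p)
          (fun i _ => Real.rpow_nonneg (hb i) p) hi₀

/-- The measure of `(0, δ]` decays at most polynomially as `δ → 0`. -/
lemma exists_le_muMeasure_Ioc {α : ℝ} (hα : -1 < α) :
    ∃ (g : ℝ) (b : ℕ), 0 < g ∧ ∀ δ : ℝ, 0 < δ → δ ≤ 1 →
      g * δ ^ b ≤ (muMeasure α).real (Set.Ioc 0 δ) := by
  have := isFiniteMeasure_muMeasure hα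
  -- On (0, 1] one has σ^α ≥ σ^b, and the increasing power σ^b is at least (δ/2)^b on (δ/2, δ],
  -- whatever the sign of α.
  obtain ⟨b, hb⟩ := exists_nat_ge α
  set G : ℝ := 2 ^ (α + 1) / Real.Gamma (α + 1) with hG
  have hG0 : 0 < G := div_pos (by positivity) (Real.Gamma_pos_of_pos (by linarith))
  refine ⟨G * Real.exp (-2) / 2 ^ (b + 1), b + 1, by positivity, fun δ hδ0 hδ1 => ?_⟩
  have h1 : ENNReal.ofReal (G * (δ / 2) ^ b * Real.exp (-2)) * ENNReal.ofReal (δ / 2) ≤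
      muMeasure α (Set.Ioc (δ / 2) δ) := by
    rw [muMeasure, withDensity_apply _ measurableSet_Ioc, Measure.restrict_restrict
      measurableSet_Ioc, Set.inter_eq_self_of_subset_left]
    · have hvol : volume (Set.Ioc (δ / 2) δ) = ENNReal.ofReal (δ / 2) := by
        rw [Real.volume_Ioc]; congr 1; ring
      rw [← hvol, ← setLIntegral_const]
      refine setLIntegral_mono (measurable_muMeasure_density α) fun σ hσ => ?_
      refine ENNReal.ofReal_le_ofReal ?_
      have hσ0 : 0 < σ := lt_trans (by positivity) hσ.1
      have hσ1 : σ ≤ 1 := hσ.2.trans hδ1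
      have h2 : (δ / 2) ^ b ≤ σ ^ α := by
        calc (δ / 2) ^ b ≤ σ ^ b := pow_le_pow_left₀ (by positivity) hσ.1.le b
          _ = σ ^ (b : ℝ) := (Real.rpow_natCast σ b).symm
          _ ≤ σ ^ α := Real.rpow_le_rpow_of_exponent_ge hσ0 hσ1 hb
      gcongr
      linarith
    · exact fun σ hσ => lt_trans (by positivity : 0 < δ / 2) hσ.1
  have h2 : muMeasure α (Set.Ioc (δ / 2) δ) ≤ muMeasure α (Set.Ioc 0 δ) :=
    measure_mono (Set.Ioc_subset_Ioc_left (by positivity))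
  rw [← ENNReal.ofReal_mul (by positivity)] at h1
  have h3 := ENNReal.toReal_mono (measure_ne_top _ _) (h1.trans h2)
  rw [ENNReal.toReal_ofReal (by positivity)] at h3
  refine le_trans (le_of_eq ?_) h3
  rw [div_pow, pow_succ, pow_succ]
  field_simp

namespace DirichletPolynomial

lemma le_mixedIntegral {u v α : ℝ} (hu : 0 < u) (hv : 0 < v) (hα : -1 < α)
    {P : DirichletPolynomial} {B δ : ℝ} (hB : 0 ≤ B)
    (h : ∀ σ, 0 < σ → σ ≤ δ → B ≤ (P.translate σ).hardyNorm u) :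
    B ^ v * (muMeasure α).real (Set.Ioc 0 δ) ≤ P.mixedIntegral u v α := by
  have := isFiniteMeasure_muMeasure hα
  have h1 : ∫ σ, (Set.Ioc 0 δ).indicator (fun _ => B ^ v) σ ∂muMeasure α =
      B ^ v * (muMeasure α).real (Set.Ioc 0 δ) := by
    rw [integral_indicator_const _ measurableSet_Ioc, smul_eq_mul, mul_comm]
  rw [← h1]
  refine integral_mono ((integrable_const _).indicator measurableSet_Ioc)
    (integrable_hardyNorm_translate_rpow hu hv hα P) fun σ => ?_
  by_cases hσ : σ ∈ Set.Ioc 0 δ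
  · rw [Set.indicator_of_mem hσ]
    exact Real.rpow_le_rpow hB (h σ hσ.1 hσ.2) hv.le
  · rw [Set.indicator_of_notMem hσ]
    exact Real.rpow_nonneg (hardyNorm_nonneg _ _) _

/-- The projection onto the homogeneous part of degree `m` with respect to the weight `w`. -/
def homogeneousPart (w : ℕ → ℕ) (m : ℕ) (P : DirichletPolynomial) : DirichletPolynomial :=
  P.multiplier fun n => if weightedOmega w n = m then 1 else 0

lemma hardyNorm_homogeneousPart_le (w : ℕ → ℕ) (P : DirichletPolynomial) (m : ℕ) {p : ℝ}
    (hp : 0 < p) {r : ℝ} (hr0 : 0 < r) (hr : r < 1) :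
    (P.homogeneousPart w m).hardyNorm p ≤
      ((1 + r) / (1 - r)) ^ (1 / p) * (r ^ m)⁻¹ * P.hardyNorm p := by
  have h := hardyIntegral_homogeneous_le w P m hp hr0.le hr
  have hD : 0 ≤ (1 + r) / (1 - r) := div_nonneg (by linarith) (by linarith)
  have h1 := Real.rpow_le_rpow (mul_nonneg (by positivity) (hardyIntegral_nonneg _ _)) h
    (one_div_nonneg.2 hp.le)
  rw [Real.mul_rpow (by positivity) (hardyIntegral_nonneg _ _),
    Real.mul_rpow hD (hardyIntegral_nonneg _ _), ← Real.rpow_mul (by positivity),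
    mul_one_div_cancel hp.ne', Real.rpow_one, ← hardyNorm_eq, ← hardyNorm_eq] at h1
  have hrm : 0 < r ^ m := by positivity
  rw [mul_right_comm, ← div_eq_mul_inv, le_div_iff₀ hrm, mul_comm]
  exact h1

/-- Translation and projection are both coefficient multipliers, hence commute, and the Hardy bound
applies for each σ. -/
lemma mixedIntegral_homogeneousPart_le (w : ℕ → ℕ) (P : DirichletPolynomial) (m : ℕ) {u v α : ℝ}
    (hu : 0 < u) (hv : 0 < v) (hα : -1 < α) {r : ℝ} (hr0 : 0 < r) (hr : r < 1) :
    (P.homogeneousPart w m).mixedIntegral u v α ≤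
      (((1 + r) / (1 - r)) ^ (1 / u) * (r ^ m)⁻¹) ^ v * P.mixedIntegral u v α := by
  have hD : 0 ≤ (1 + r) / (1 - r) := div_nonneg (by linarith) (by linarith)
  rw [mixedIntegral, mixedIntegral, ← integral_const_mul]
  refine integral_mono (integrable_hardyNorm_translate_rpow hu hv hα _)
    ((integrable_hardyNorm_translate_rpow hu hv hα _).const_mul _) fun σ => ?_
  have e : (P.homogeneousPart w m).translate σ = (P.translate σ).homogeneousPart w m := by
    ext n
    simp only [homogeneousPart, translate_eq_multiplier, multiplier_apply]
    ring
  simp only [e]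
  rw [← Real.mul_rpow (by positivity) (hardyNorm_nonneg _ _)]
  exact Real.rpow_le_rpow (hardyNorm_nonneg _ _) (hardyNorm_homogeneousPart_le w _ m hu hr0 hr)
    hv.le

/-- Polynomials with support in a fixed finite set tend to zero in the mixed (quasi-)norm if they
do so coefficientwise. -/
lemma tendsto_mixedIntegral_zero {u v α : ℝ} (hu : 0 < u) (hv : 0 < v) (hα : -1 < α)
    {E : ℕ → DirichletPolynomial} {S : Finset ℕ+} (hS : ∀ j, (E j).support ⊆ S)
    (hE : ∀ n, Tendsto (fun j => E j n) atTop (𝓝 0)) :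
    Tendsto (fun j => (E j).mixedIntegral u v α) atTop (𝓝 0) := by
  have h1 : Tendsto (fun j => ∑ n ∈ S, ‖E j n‖) atTop (𝓝 0) := by
    simpa using tendsto_finsetSum S fun n _ => (hE n).norm
  have h2 := (h1.rpow_const (p := v) (Or.inr hv.le)).const_mul ((muMeasure α).real Set.univ)
  rw [Real.zero_rpow hv.ne', mul_zero] at h2
  refine squeeze_zero (fun j => mixedIntegral_nonneg _ _ _ _) (fun j => ?_) h2
  exact mixedIntegral_le_of_hardyNorm_le hu hv hα (hardyNorm_le_of_norm_le hu
    (Finset.sum_nonneg fun _ _ => norm_nonneg _) (norm_bohrLift_le (hS j)))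

end DirichletPolynomial

/-! ### A series in H^p outside the mixed norm space when p < u -/

/-- The Dirichlet series `∑_k γ^k Q_k`, where `Q_k` is `pairPolynomial k`. -/
def pairSeries (γ : ℝ) : DirichletSeries := fun n =>
  (γ : ℂ) ^ weightedOmega (fun _ => 1) n * pairPolynomial (weightedOmega (fun _ => 1) n) n

/-- The partial sums of `pairSeries`. -/
def pairPartialSum (γ : ℝ) (K : ℕ) : DirichletPolynomial :=
  ∑ k ∈ Finset.range K, ((γ : ℂ) ^ k) • pairPolynomial k

lemma pairSeries_mem_convergentDirichletSeries {γ : ℝ} (hγ0 : 0 ≤ γ) (hγ : γ ≤ 1) :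
    pairSeries γ ∈ convergentDirichletSeries := by
  refine mem_convergentDirichletSeries_of_le (C := 1) fun n => ?_
  rw [pairSeries, norm_mul, norm_pow, Complex.norm_real, Real.norm_of_nonneg hγ0]
  refine mul_le_mul (pow_le_one₀ hγ0 hγ) ?_ (norm_nonneg _) zero_le_one
  refine (norm_pairPolynomial_apply_le _ n).trans ?_
  exact_mod_cast two_pow_weightedOmega_le n

lemma tendsto_pairPartialSum (γ : ℝ) (n : ℕ+) :
    Tendsto (fun K => pairPartialSum γ K n) atTop (𝓝 (pairSeries γ n)) := by
  refine tendsto_const_nhds.congr' ?_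
  filter_upwards [eventually_gt_atTop (weightedOmega (fun _ => 1) n)] with K hK
  rw [pairPartialSum, Finsupp.finsetSum_apply, Finset.sum_eq_single_of_mem _
    (Finset.mem_range.2 hK)]
  · rfl
  · intro k _ hk
    rw [Finsupp.smul_apply, smul_eq_mul]
    by_contra h
    exact hk (weightedOmega_one_of_ne_zero (right_ne_zero_of_mul h)).symm

/-- The i-th term has H^p norm θ^{2i}. One factor θ^i pays for the geometric weight in
`Real.sum_rpow_le_geometric`, and the other makes the remaining sum converge. -/
lemma hardyIntegral_pairPartialSum_sub_le {p θ : ℝ} (hp : 0 < p) (hθ0 : 0 < θ) (hθ : θ < 1)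
    {k j : ℕ} (hkj : k ≤ j) :
    (pairPartialSum (θ ^ 2 / circleMean p ^ (1 / p)) j -
      pairPartialSum (θ ^ 2 / circleMean p ^ (1 / p)) k).hardyIntegral p ≤
      (1 - θ)⁻¹ ^ p * ((θ ^ p) ^ k / (1 - θ ^ p)) := by
  set A := circleMean p with hA
  have hA0 : 0 < A := zero_lt_one.trans_le (one_le_circleMean hp)
  set γ := θ ^ 2 / A ^ (1 / p) with hγ
  have hγ0 : 0 < γ := by positivity
  have hθp : θ ^ p < 1 := Real.rpow_lt_one hθ0.le hθ hp
  have hint : ∀ i ∈ Finset.Ico k j, Integrable (fun x =>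
      ((θ ^ i)⁻¹ * ‖(((γ : ℂ) ^ i) • pairPolynomial i).bohrLift x‖) ^ p) primeTorusMeasure := by
    intro i _
    simp only [fun x => Real.mul_rpow (z := p) (inv_nonneg.2 (pow_nonneg hθ0.le i))
      (norm_nonneg ((((γ : ℂ) ^ i) • pairPolynomial i).bohrLift x))]
    exact (integrable_norm_bohrLift_rpow hp _).const_mul _
  have hval : ∀ i, ∫ x, ((θ ^ i)⁻¹ * ‖(((γ : ℂ) ^ i) • pairPolynomial i).bohrLift x‖) ^ p
      ∂primeTorusMeasure = (θ ^ p) ^ i := by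
    intro i
    simp only [fun x => Real.mul_rpow (z := p) (inv_nonneg.2 (pow_nonneg hθ0.le i))
      (norm_nonneg ((((γ : ℂ) ^ i) • pairPolynomial i).bohrLift x))]
    rw [integral_const_mul]
    change ((θ ^ i)⁻¹) ^ p * hardyIntegral p _ = _
    rw [hardyIntegral_smul, hardyIntegral_pairPolynomial hp, norm_pow, Complex.norm_real,
      Real.norm_of_nonneg hγ0.le, ← mul_assoc,
      ← Real.mul_rpow (by positivity) (by positivity), ← inv_pow, ← mul_pow,
      ← Real.rpow_natCast, ← Real.rpow_mul (by positivity), mul_comm (i : ℝ),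
      Real.rpow_mul (by positivity), Real.rpow_natCast, ← mul_pow]
    congr 1
    have e : θ⁻¹ * γ = θ / A ^ (1 / p) := by rw [hγ]; field_simp
    rw [e, Real.div_rpow hθ0.le (by positivity), ← Real.rpow_mul hA0.le,
      one_div_mul_cancel hp.ne', Real.rpow_one, ← hA, div_mul_cancel₀ _ hA0.ne']
  calc (pairPartialSum γ j - pairPartialSum γ k).hardyIntegral p
      ≤ ∫ x, (1 - θ)⁻¹ ^ p * ∑ i ∈ Finset.Ico k j,
          ((θ ^ i)⁻¹ * ‖(((γ : ℂ) ^ i) • pairPolynomial i).bohrLift x‖) ^ p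
          ∂primeTorusMeasure := by
        refine integral_mono (integrable_norm_bohrLift_rpow hp _)
          ((integrable_finsetSum _ hint).const_mul _) fun x => ?_
        rw [pairPartialSum, pairPartialSum, ← Finset.sum_Ico_eq_sub _ hkj, bohrLift_sum]
        refine (Real.rpow_le_rpow (norm_nonneg _) (norm_sum_le _ _) hp.le).trans ?_
        exact Real.sum_rpow_le_geometric hθ0 hθ hp (fun i => norm_nonneg _) _
    _ = (1 - θ)⁻¹ ^ p * ∑ i ∈ Finset.Ico k j, (θ ^ p) ^ i := by
        rw [integral_const_mul, integral_finsetSum _ hint]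
        simp only [hval]
    _ ≤ _ := by
        refine mul_le_mul_of_nonneg_left (geom_sum_Ico_le_of_lt_one (by positivity) hθp) ?_
        exact Real.rpow_nonneg (inv_nonneg.2 (by linarith)) _

lemma pairSeries_mem_hardySpace {p θ : ℝ} (hp : 0 < p) (hθ0 : 0 < θ) (hθ : θ < 1) :
    pairSeries (θ ^ 2 / circleMean p ^ (1 / p)) ∈ hardySpace p := by
  have hA := one_le_circleMean hp
  have hA1 : 1 ≤ circleMean p ^ (1 / p) := Real.one_le_rpow hA (by positivity)
  refine ⟨pairSeries_mem_convergentDirichletSeries (by positivity) ?_, pairPartialSum _, ?_,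
    tendsto_pairPartialSum _⟩
  · rw [div_le_one (by positivity)]
    exact (pow_le_one₀ hθ0.le hθ.le).trans hA1
  have hθp : θ ^ p < 1 := Real.rpow_lt_one hθ0.le hθ hp
  have hlim : Tendsto (fun k : ℕ => (1 - θ)⁻¹ ^ p * ((θ ^ p) ^ k / (1 - θ ^ p))) atTop (𝓝 0) := by
    simpa using ((tendsto_pow_atTop_nhds_zero_of_lt_one (by positivity) hθp).div_const
      (1 - θ ^ p)).const_mul ((1 - θ)⁻¹ ^ p)
  intro ε hε
  obtain ⟨K, hK⟩ := eventually_atTop.1 (hlim.eventually_lt_const (Real.rpow_pos_of_pos hε p))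
  refine ⟨K, fun j k hj hk => ?_⟩
  rw [hardyNorm_lt_iff hp hε.le]
  rcases le_total k j with h | h
  · exact (hardyIntegral_pairPartialSum_sub_le hp hθ0 hθ h).trans_lt (hK k hk)
  · rw [← neg_sub, hardyIntegral_neg]
    exact (hardyIntegral_pairPartialSum_sub_le hp hθ0 hθ h).trans_lt (hK j hj)

/-- If `pairSeries γ` belongs to the mixed norm space, then its homogeneous parts grow more slowly
than any exponential. -/
lemma exists_mixedIntegral_pairPolynomial_le {u v α γ : ℝ} (hu : 0 < u) (hv : 0 < v)
    (hα : -1 < α) (h : pairSeries γ ∈ mixedNormSpace u v α) {r : ℝ} (hr0 : 0 < r) (hr : r < 1) :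
    ∃ C : ℝ, ∀ k : ℕ,
      (((γ : ℂ) ^ k) • pairPolynomial k).mixedIntegral u v α ≤ C * ((r ^ k)⁻¹) ^ v := by
  obtain ⟨-, P, hP, hlim⟩ := h
  obtain ⟨C, hC0, hC⟩ := exists_mixedIntegral_add_le hu hv hα
  obtain ⟨J, hJ⟩ := hP 1 one_pos
  have hM : ∀ j, J ≤ j → (P j).mixedIntegral u v α ≤
      C * (1 + (P J).mixedIntegral u v α) := by
    intro j hj
    have h1 := (mixedNorm_lt_iff hv zero_le_one).1 (hJ j J hj le_rfl)
    rw [Real.one_rpow] at h1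
    have h2 := hC (P j - P J) (P J)
    rw [sub_add_cancel] at h2
    exact h2.trans (mul_le_mul_of_nonneg_left (by linarith) hC0.le)
  set D := ((1 + r) / (1 - r)) ^ (1 / u) with hD
  have hD0 : 0 ≤ D := Real.rpow_nonneg (div_nonneg (by linarith) (by linarith)) _
  refine ⟨C * (D ^ v * (C * (1 + (P J).mixedIntegral u v α))), fun k => ?_⟩
  -- The homogeneous part of the series is compared with that of P_j. The difference has support in
  -- a finite set independent of j and tends to 0 coefficientwise, hence in the mixed norm.
  set E : ℕ → DirichletPolynomial := fun j =>
    ((γ : ℂ) ^ k) • pairPolynomial k - (P j).homogeneousPart (blockWeight k) k with hE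
  have happ : ∀ j n, E j n = if weightedOmega (blockWeight k) n = k then
      pairSeries γ n - P j n else 0 := by
    intro j n
    simp only [hE, homogeneousPart, Finsupp.sub_apply, Finsupp.smul_apply, smul_eq_mul,
      multiplier_apply]
    split_ifs with hn
    · rw [pairSeries, weightedOmega_one_of_blockWeight hn, one_mul]
    · rw [zero_mul, sub_zero]
      by_contra h0
      exact hn (weightedOmega_blockWeight_of_ne_zero (right_ne_zero_of_mul h0))
  have hE0 : Tendsto (fun j => (E j).mixedIntegral u v α) atTop (𝓝 0) := by
    refine tendsto_mixedIntegral_zero hu hv hα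
      (S := Finset.Icc 1 ((2 ^ (2 * k)) ^ k)) (fun j n hn => ?_) fun n => ?_
    · rw [Finsupp.mem_support_iff, happ] at hn
      rw [Finset.mem_Icc]
      refine ⟨one_le, ?_⟩
      rw [← PNat.coe_le_coe]
      simpa using le_two_pow_of_blockWeight (by by_contra h0; exact hn (if_neg h0))
    · simp only [happ]
      split_ifs
      · simpa using (hlim n).const_sub (pairSeries γ n)
      · exact tendsto_const_nhds
  have hbound : ∀ᶠ j in atTop, (((γ : ℂ) ^ k) • pairPolynomial k).mixedIntegral u v α ≤
      C * ((E j).mixedIntegral u v α + (D * (r ^ k)⁻¹) ^ v *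
        (C * (1 + (P J).mixedIntegral u v α))) := by
    filter_upwards [eventually_ge_atTop J] with j hj
    have h1 := hC (E j) ((P j).homogeneousPart (blockWeight k) k)
    rw [hE, sub_add_cancel] at h1
    refine h1.trans (mul_le_mul_of_nonneg_left (add_le_add le_rfl ?_) hC0.le)
    exact (mixedIntegral_homogeneousPart_le _ _ _ hu hv hα hr0 hr).trans
      (mul_le_mul_of_nonneg_left (hM j hj) (by positivity))
  have hfin := ge_of_tendsto ((hE0.add_const ((D * (r ^ k)⁻¹) ^ v *
        (C * (1 + (P J).mixedIntegral u v α)))).const_mul C) hbound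
  refine hfin.trans_eq ?_
  rw [zero_add, Real.mul_rpow hD0 (by positivity)]
  ring

/-- Only σ ≤ 1/(2k²) is used: there translation keeps at least half of the norm, and the mass of
that interval is at least a power of 1/k. -/
lemma le_mixedIntegral_pairPolynomial {u v α γ g : ℝ} {b : ℕ} (hu : 0 < u) (hv : 0 < v)
    (hα : -1 < α) (hγ : 0 ≤ γ)
    (hg : ∀ δ : ℝ, 0 < δ → δ ≤ 1 → g * δ ^ b ≤ (muMeasure α).real (Set.Ioc 0 δ)) {k : ℕ}
    (hk : 0 < k) :
    (1 / 2 * (γ * circleMean u ^ (1 / u)) ^ k) ^ v * (g * (1 / (2 * (k : ℝ) ^ 2)) ^ b) ≤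
      (((γ : ℂ) ^ k) • pairPolynomial k).mixedIntegral u v α := by
  have hA0 : 0 ≤ circleMean u := zero_le_one.trans (one_le_circleMean hu)
  have hk1 : (1 : ℝ) ≤ k := by exact_mod_cast hk
  have hδ : 1 / (2 * (k : ℝ) ^ 2) ≤ 1 := by
    rw [div_le_one (by positivity)]
    nlinarith
  refine le_trans (mul_le_mul_of_nonneg_left (hg _ (by positivity) hδ) (by positivity))
    (le_mixedIntegral hu hv hα (by positivity) fun σ hσ0 hσ => ?_)
  rw [translate_smul, hardyNorm_smul hu, norm_pow, Complex.norm_real, Real.norm_of_nonneg hγ]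
  have h1 := hardyNorm_translate_pairPolynomial_ge hu (k := k) hσ0.le (by
    rw [le_div_iff₀ (by positivity)] at hσ
    linarith)
  have h2 : (pairPolynomial k).hardyNorm u = (circleMean u ^ (1 / u)) ^ k := by
    rw [hardyNorm_eq, hardyIntegral_pairPolynomial hu, ← Real.rpow_natCast,
      ← Real.rpow_mul hA0, mul_comm, Real.rpow_mul hA0, Real.rpow_natCast]
  rw [h2] at h1
  calc 1 / 2 * (γ * circleMean u ^ (1 / u)) ^ k
      = γ ^ k * (1 / 2 * (circleMean u ^ (1 / u)) ^ k) := by rw [mul_pow]; ring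
    _ ≤ _ := mul_le_mul_of_nonneg_left h1 (by positivity)

theorem not_hardySpace_subset_mixedNormSpace {p u v α : ℝ} (hp : 0 < p) (hv : 0 < v)
    (hα : -1 < α) (hpu : p < u) : ¬ hardySpace p ⊆ mixedNormSpace u v α := by
  intro hsub
  have hu := hp.trans hpu
  set a := circleMean p ^ (1 / p) with ha
  set c := circleMean u ^ (1 / u) with hc
  have ha1 : 1 ≤ a := Real.one_le_rpow (one_le_circleMean hp) (by positivity)
  have ha0 : 0 < a := by positivity
  have hac : a < c := circleMean_rpow_lt hp hpu
  have hc0 : 0 < c := ha0.trans hac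
  have hcont : Tendsto (fun θ : ℝ => θ ^ 3 * (c / a)) (𝓝[<] 1) (𝓝 (c / a)) := by
    have : Continuous fun θ : ℝ => θ ^ 3 * (c / a) := by fun_prop
    simpa using (this.tendsto 1).mono_left nhdsWithin_le_nhds
  -- Two of the three factors θ come from γ = θ²/a, the third from the projection bound with r = θ.
  -- Since c/a > 1, some θ < 1 leaves exponential growth.
  obtain ⟨θ, hθc, hθ0, hθ1⟩ := ((hcont.eventually_const_lt ((one_lt_div ha0).2 hac)).and
    (Ioo_mem_nhdsLT (zero_lt_one (α := ℝ)))).exists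
  have hmem := hsub (pairSeries_mem_hardySpace hp hθ0 hθ1)
  rw [← ha] at hmem
  obtain ⟨C, hC⟩ := exists_mixedIntegral_pairPolynomial_le hu hv hα hmem hθ0 hθ1
  obtain ⟨g, b, hg0, hg⟩ := exists_le_muMeasure_Ioc hα
  set x := (θ ^ 3 * (c / a)) ^ v with hx
  have hx1 : 1 < x := Real.one_lt_rpow hθc hv
  have hx0 : 0 < x := zero_lt_one.trans hx1
  -- Comparing the two bounds for γ^k Q_k puts a fixed positive constant below C k^{2b} / x^k, which
  -- tends to 0 because x > 1.
  have hkey : ∀ k : ℕ, 0 < k → (1 / 2) ^ v * g * (1 / 2) ^ b ≤ C * ((k : ℝ) ^ (2 * b) / x ^ k) := by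
    intro k hk
    have hk0 : (0 : ℝ) < k := by exact_mod_cast hk
    have h1 := (le_mixedIntegral_pairPolynomial hu hv hα (γ := θ ^ 2 / a) (by positivity) hg
      hk).trans (hC k)
    rw [← hc] at h1
    have hθk : 0 < (θ ^ k) ^ v := by positivity
    have h2 : (1 / 2 * (θ ^ 2 / a * c) ^ k) ^ v * (θ ^ k) ^ v = (1 / 2) ^ v * x ^ k := by
      rw [← Real.mul_rpow (by positivity) (by positivity), mul_assoc, ← mul_pow,
        Real.mul_rpow (by positivity) (by positivity), hx, ← Real.rpow_natCast (_ ^ v),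
        ← Real.rpow_mul (by positivity), mul_comm v, Real.rpow_mul (by positivity),
        Real.rpow_natCast]
      congr 3
      ring
    rw [Real.inv_rpow (by positivity), ← div_eq_mul_inv, le_div_iff₀ hθk] at h1
    have h3 : (1 / 2 * (θ ^ 2 / a * c) ^ k) ^ v * (g * (1 / (2 * (k : ℝ) ^ 2)) ^ b) * (θ ^ k) ^ v =
        (1 / 2) ^ v * g * (1 / 2) ^ b * (x ^ k / (k : ℝ) ^ (2 * b)) := by
      rw [mul_right_comm, h2, pow_mul, one_div_pow, mul_pow, one_div_pow]
      field_simp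
    rw [h3, ← le_div_iff₀ (by positivity)] at h1
    refine h1.trans_eq ?_
    field_simp
  have hlim : Tendsto (fun k : ℕ => C * ((k : ℝ) ^ (2 * b) / x ^ k)) atTop (𝓝 0) := by
    simpa using (tendsto_pow_const_div_const_pow_of_one_lt (2 * b) hx1).const_mul C
  have hpos : 0 < (1 / 2 : ℝ) ^ v * g * (1 / 2) ^ b := by positivity
  obtain ⟨k, hk, hk0⟩ := ((hlim.eventually_lt_const hpos).and (eventually_gt_atTop 0)).exists
  exact absurd (hkey k hk0) (not_le.2 hk)

theorem proposition4p4 (p u v α : ℝ) (hp : 0 < p) (hu : 0 < u) (hv : 0 < v) (hα : -1 < α) :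
    (hardySpace p ⊆ mixedNormSpace u v α ↔ u ≤ p) ∧
    ¬ (mixedNormSpace u v α ⊆ hardySpace p) ∧
    (lacunarySeries ∈ mixedNormSpace u v α ∧ lacunarySeries ∉ hardySpace p) := by
  have h1 := lacunarySeries_mem_mixedNormSpace hu hv hα
  have h2 := lacunarySeries_notMem_hardySpace hp
  refine ⟨⟨fun h => ?_, hardySpace_subset_mixedNormSpace_of_le hu hv hα⟩, fun h => h2 (h h1),
    h1, h2⟩
  by_contra hlt
  exact not_hardySpace_subset_mixedNormSpace hp hv hα (not_le.1 hlt) h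

end
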